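/- **Setting.** An instance consists of finitely many jobs $j$, each with a release date $r_j\ge 0$ and a processing time $p_j>0$. A feasible (preemptive, single-machine) schedule is described by the amounts $y_j(t)$ of processing that the jobs have received until time $t$: each $y_j$ is non-decreasing, $y_j(t)=0$ for $t\le r_j$, $y_j(t)\le p_j$, all jobs together receive at most $t_2-t_1$ units of processing during $[t_1,t_2]$, and every job is eventually completed. The completion time $C_j$ is the earliest time $t$ with $y_j(t)=p_j$, and the total flow time is $\sum_j (C_j-r_j)$. For $\alpha\in[0,1)$, job $j$ emits a signal at the earliest time $s_j\ge r_j$ with $y_j(s_j)=\alpha p_j$. A (deterministic) algorithm maps every instance to a feasible schedule. It is an *$\alpha$-clairvoyant online algorithm* if its schedule until time $t$ depends only on the jobs released until $t$ and their release dates, the signals emitted until $t$ and their times, and the processing times of the jobs that have emitted their signal until $t$. It is *$c$-competitive* if on every instance its total flow time is at most $c$ times the total flow time of an optimal (equivalently, of every) feasible schedule. **Theorem.** There is an absolute constant $K>0$ such that for every $\alpha\in[0,1)$ there is an $\alpha$-clairvoyant online algorithm that is $\frac{K}{1-\alpha}$-competitive for total flow time on a single machine. Moreover, the algorithm can be taken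 to follow this rule at every time $t$. Let $A(t)=\{j: r_j\le t<C_j\}$, let $C(t)$ be the set of jobs in $A(t)$ that have emitted their signal by time $t$ (that is, $y_j(t)\ge\alpha p_j$), let $N(t)=A(t)\setminus C(t)$, and put $p_j(t)=p_j-y_j(t)$; a minimum over the empty set is $\infty$. 1. If $C(t)\neq\emptyset$ and $\min_{j\in C(t)}p_j(t)\le\frac{1-\alpha}{\alpha}\min_{j\in N(t)}y_j(t)$ (which counts as true if $N(t)=\emptyset$, in particular always if $\alpha=0$), process at rate $1$ only one job of $C(t)$ with smallest $p_j(t)$, chosen among those to have the largest $s_j$. 2. Otherwise, share the machine evenly among the jobs of $N(t)$ with smallest $y_j(t)$, and process no other job. -/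

import Mathlib

namespace FlowTime

/-- An instance: a finite set of jobs (with arbitrary names), each with a release date `r j`
and a processing time `p j`. The values of `r` and `p` outside `jobs` play no role. -/
structure Instance where
  jobs : Finset ℕ
  r : ℕ → ℝ
  p : ℕ → ℝ
  r_nonneg : ∀ j ∈ jobs, 0 ≤ r j
  p_pos : ∀ j ∈ jobs, 0 < p j

/-- A feasible preemptive schedule on one machine of speed `1`, given by the amount `y j t` of
processing that job `j` has received until time `t`. The machine may be shared among
several jobs (rates that add up to at most `1`), and every job is eventually completed. -/
structure Schedule (I : Instance) where
  y : ℕ → ℝ → ℝ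
  mono : ∀ j ∈ I.jobs, Monotone (y j)
  eq_zero : ∀ j ∈ I.jobs, ∀ t ≤ I.r j, y j t = 0
  le_p : ∀ j ∈ I.jobs, ∀ t, y j t ≤ I.p j
  capacity : ∀ s t, s ≤ t → ∑ j ∈ I.jobs, (y j t - y j s) ≤ t - s
  completes : ∀ j ∈ I.jobs, ∃ t, y j t = I.p j

namespace Schedule

variable {I : Instance}

/-- The remaining processing time `p_j(t)`. -/
def rem (S : Schedule I) (j : ℕ) (t : ℝ) : ℝ := I.p j - S.y j t

/-- The completion time `C_j`. -/
noncomputable def completion (S : Schedule I) (j : ℕ) : ℝ :=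
  sInf {t : ℝ | I.r j ≤ t ∧ S.y j t = I.p j}

/-- The total flow time of a schedule. -/
noncomputable def flowTime (S : Schedule I) : ℝ :=
  ∑ j ∈ I.jobs, (S.completion j - I.r j)

/-- Job `j` has been released and has emitted its signal by time `t`, that is, an `α`-fraction
of it has been processed. -/
def Emitted (S : Schedule I) (α : ℝ) (j : ℕ) (t : ℝ) : Prop :=
  j ∈ I.jobs ∧ I.r j ≤ t ∧ α * I.p j ≤ S.y j t

/-- The time `s_j` at which job `j` emits its signal. -/
noncomputable def emission (S : Schedule I) (α : ℝ) (j : ℕ) : ℝ :=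
  sInf {t : ℝ | S.Emitted α j t}

open Classical in
/-- The set `A(t)` of available jobs. -/
noncomputable def available (S : Schedule I) (t : ℝ) : Finset ℕ :=
  {j ∈ I.jobs | I.r j ≤ t ∧ t < S.completion j}

open Classical in
/-- The available jobs that have emitted their signal. -/
noncomputable def clairvoyant (S : Schedule I) (α : ℝ) (t : ℝ) : Finset ℕ :=
  {j ∈ S.available t | S.Emitted α j t}

open Classical in
/-- The available jobs that have not emitted their signal. -/
noncomputable def nonclairvoyant (S : Schedule I) (α : ℝ) (t : ℝ) : Finset ℕ :=
  {j ∈ S.available t | ¬ S.Emitted α j t}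

/-- Job `j` is processed at rate `x` at time `t` (right derivative of its progress). -/
def HasRate (S : Schedule I) (j : ℕ) (x : ℝ) (t : ℝ) : Prop :=
  HasDerivWithinAt (S.y j) x (Set.Ici t) t

/-- The test `min_{j ∈ C} p_j(t) ≤ (1 - α) / α * min_{j ∈ N} y_j(t)`, where `C` and `N` are the
clairvoyant and the non-clairvoyant jobs and a minimum over the empty set is `∞`
(if `C` and `N` are both empty, there is nothing to schedule and the test does not matter). -/
def SRPTTest (S : Schedule I) (α : ℝ) (t : ℝ) : Prop :=
  ∃ k ∈ S.clairvoyant α t, ∀ j ∈ S.nonclairvoyant α t, S.rem k t ≤ (1 - α) / α * S.y j t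

/-- At time `t` only one job `k` is processed (at rate `1`); it is a clairvoyant job of smallest
remaining processing time, and among those one that emitted its signal last. -/
def RunsSRPT (S : Schedule I) (α : ℝ) (t : ℝ) : Prop :=
  ∃ k ∈ S.clairvoyant α t,
    (∀ j ∈ S.clairvoyant α t, S.rem k t ≤ S.rem j t) ∧
    (∀ j ∈ S.clairvoyant α t, S.rem j t = S.rem k t → S.emission α j ≤ S.emission α k) ∧
    ∀ j ∈ I.jobs, S.HasRate j (if j = k then 1 else 0) t

open Classical in
/-- The non-clairvoyant jobs that have received the smallest amount of processing. -/
noncomputable def leastProcessed (S : Schedule I) (α : ℝ) (t : ℝ) : Finset ℕ :=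
  {j ∈ S.nonclairvoyant α t | ∀ i ∈ S.nonclairvoyant α t, S.y j t ≤ S.y i t}

/-- At time `t` the machine is shared evenly among the non-clairvoyant jobs that have received
the smallest amount of processing, and no other job is processed. -/
def RunsSETF (S : Schedule I) (α : ℝ) (t : ℝ) : Prop :=
  ∀ j ∈ I.jobs, S.HasRate j
    (if j ∈ S.leastProcessed α t then 1 / ((S.leastProcessed α t).card : ℝ) else 0) t

/-- The schedule follows, at all times, the SRPT/SETF hybrid rule. -/
def IsHybrid (S : Schedule I) (α : ℝ) : Prop :=
  ∀ t : ℝ, (S.SRPTTest α t → S.RunsSRPT α t) ∧ (¬ S.SRPTTest α t → S.RunsSETF α t)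

end Schedule

/-- A deterministic algorithm assigns to every instance a feasible schedule. -/
abbrev Algorithm := (I : Instance) → Schedule I

/-- Two runs reveal the same information up to time `t`: at every time `τ ≤ t` the same jobs have
been released (so they have the same release dates), the same jobs have emitted their signal
(so the signals come at the same times), and these have the same processing times. -/
def SameInfo (α : ℝ) {I I' : Instance} (S : Schedule I) (S' : Schedule I') (t : ℝ) : Prop :=
  ∀ τ ≤ t, ∀ j,
    ((j ∈ I.jobs ∧ I.r j ≤ τ) ↔ (j ∈ I'.jobs ∧ I'.r j ≤ τ)) ∧
    (S.Emitted α j τ ↔ S'.Emitted α j τ) ∧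
    (S.Emitted α j τ → I.p j = I'.p j)

namespace Algorithm

/-- The algorithm is an `α`-clairvoyant online algorithm: what it has done until time `t` depends
only on the information revealed until time `t` in its own run. -/
def IsClairvoyantOnline (A : Algorithm) (α : ℝ) : Prop :=
  ∀ (I I' : Instance) (t : ℝ), SameInfo α (A I) (A I') t →
    ∀ j ∈ I.jobs, I.r j ≤ t → (A I).y j t = (A I').y j t

/-- The algorithm is `c`-competitive for total flow time: on every instance its total flow time is
at most `c` times that of every feasible offline schedule. -/
def IsCompetitive (A : Algorithm) (c : ℝ) : Prop :=
  ∀ (I : Instance) (S : Schedule I), (A I).flowTime ≤ c * S.flowTime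

end Algorithm

end FlowTime

namespace FlowTime

open Set Filter Topology

/-! ### Rates prescribed by the hybrid rule in a given state -/

/-- The test of the hybrid rule, for the sets `C`, `N` of clairvoyant and non-clairvoyant jobs,
processing times `p` and processed amounts `v`. -/
def StateTest (α : ℝ) (C N : Finset ℕ) (p v : ℕ → ℝ) : Prop :=
  ∃ k ∈ C, ∀ j ∈ N, p k - v k ≤ (1 - α) / α * v j

/-- `k` has the smallest remaining processing time in `C`, among those the latest emission time,
and among those the smallest name. -/
def IsSelected (C : Finset ℕ) (p v e : ℕ → ℝ) (k : ℕ) : Prop :=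
  k ∈ C ∧ (∀ j ∈ C, p k - v k ≤ p j - v j) ∧
    (∀ j ∈ C, p j - v j = p k - v k → e j ≤ e k) ∧
    ∀ j ∈ C, p j - v j = p k - v k → e j = e k → k ≤ j

open Classical in
/-- The jobs in `N` with the least amount of processing. -/
noncomputable def leastOf (N : Finset ℕ) (v : ℕ → ℝ) : Finset ℕ :=
  {j ∈ N | ∀ i ∈ N, v j ≤ v i}

open Classical in
/-- The rate at which the hybrid rule processes job `j`. -/
noncomputable def stateRate (α : ℝ) (C N : Finset ℕ) (p v e : ℕ → ℝ) (j : ℕ) : ℝ :=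
  if StateTest α C N p v then (if IsSelected C p v e j then 1 else 0)
  else if j ∈ leastOf N v then 1 / ((leastOf N v).card : ℝ) else 0

section State

variable {α : ℝ} {C N : Finset ℕ} {p v e : ℕ → ℝ}

theorem mem_leastOf {j : ℕ} : j ∈ leastOf N v ↔ j ∈ N ∧ ∀ i ∈ N, v j ≤ v i := by
  simp [leastOf]

theorem leastOf_nonempty (hN : N.Nonempty) : (leastOf N v).Nonempty := by
  obtain ⟨j, hj, hmin⟩ := N.exists_min_image v hN
  exact ⟨j, mem_leastOf.2 ⟨hj, hmin⟩⟩

theorem exists_isSelected (hC : C.Nonempty) : ∃ k, IsSelected C p v e k := by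
  classical
  obtain ⟨a, ha, hamin⟩ := C.exists_min_image (fun j => p j - v j) hC
  obtain ⟨b, hb, hbmax⟩ := (C.filter (fun j => p j - v j = p a - v a)).exists_max_image e
    ⟨a, by simp [ha]⟩
  obtain ⟨c, hc, hcmin⟩ :=
    (C.filter (fun j => p j - v j = p a - v a ∧ e j = e b)).exists_min_image (fun j => j)
    ⟨b, by simpa using hb⟩
  simp only [Finset.mem_filter] at hb hc hbmax hcmin
  refine ⟨c, hc.1, fun j hj => ?_, fun j hj h => ?_, fun j hj h h' => ?_⟩
  · rw [hc.2.1]; exact hamin j hj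
  · rw [hc.2.2]; exact hbmax j ⟨hj, by rw [h, hc.2.1]⟩
  · exact hcmin j ⟨hj, by rw [h, hc.2.1], by rw [h', hc.2.2]⟩

theorem IsSelected.unique {k l : ℕ} (hk : IsSelected C p v e k) (hl : IsSelected C p v e l) :
    k = l := by
  have h := le_antisymm (hk.2.1 l hl.1) (hl.2.1 k hk.1)
  have h' := le_antisymm (hl.2.2.1 k hk.1 h) (hk.2.2.1 l hl.1 h.symm)
  exact le_antisymm (hk.2.2.2 l hl.1 h.symm h'.symm) (hl.2.2.2 k hk.1 h h')

theorem stateRate_nonneg (j : ℕ) : 0 ≤ stateRate α C N p v e j := by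
  unfold stateRate; split_ifs <;> positivity

theorem stateRate_of_isSelected (ht : StateTest α C N p v) {k : ℕ} (hk : IsSelected C p v e k)
    (j : ℕ) : stateRate α C N p v e j = if j = k then 1 else 0 := by
  classical
  have : IsSelected C p v e j ↔ j = k := ⟨fun h => h.unique hk, fun h => h ▸ hk⟩
  simp only [stateRate, ht, if_true, this]

theorem stateRate_of_not_test (ht : ¬ StateTest α C N p v) (j : ℕ) :
    stateRate α C N p v e j =
      if j ∈ leastOf N v then 1 / ((leastOf N v).card : ℝ) else 0 := by
  simp only [stateRate, ht, if_false]

theorem StateTest.nonempty (ht : StateTest α C N p v) : C.Nonempty :=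
  let ⟨k, hk, _⟩ := ht; ⟨k, hk⟩

theorem mem_of_stateRate_ne_zero {j : ℕ} (h : stateRate α C N p v e j ≠ 0) : j ∈ C ∪ N := by
  unfold stateRate at h
  split_ifs at h with h1 h2 h3
  · exact Finset.mem_union_left _ h2.1
  · exact absurd rfl h
  · exact Finset.mem_union_right _ (mem_leastOf.1 h3).1
  · exact absurd rfl h

theorem sum_stateRate_le_one (s : Finset ℕ) : ∑ j ∈ s, stateRate α C N p v e j ≤ 1 := by
  by_cases ht : StateTest α C N p v
  · obtain ⟨k, hk⟩ := exists_isSelected (p := p) (v := v) (e := e) ht.nonempty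
    simp only [stateRate_of_isSelected ht hk, Finset.sum_ite_eq']
    split_ifs <;> norm_num
  · simp only [stateRate_of_not_test ht]
    rw [← Finset.sum_filter, Finset.sum_const, nsmul_eq_mul, mul_one_div]
    refine div_le_one_of_le₀ ?_ (by positivity)
    exact_mod_cast Finset.card_le_card fun j hj => (Finset.mem_filter.1 hj).2

theorem stateTest_of_empty (hC : C.Nonempty) : StateTest α C ∅ p v := by
  obtain ⟨k, hk⟩ := hC
  exact ⟨k, hk, by simp⟩

theorem nonempty_of_not_test (ht : ¬ StateTest α C N p v) (hne : (C ∪ N).Nonempty) :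
    N.Nonempty := by
  rw [Finset.nonempty_iff_ne_empty]
  rintro rfl
  exact ht (stateTest_of_empty (by simpa using hne))

theorem sum_stateRate_eq_one {s : Finset ℕ} (hne : (C ∪ N).Nonempty) (hs : C ∪ N ⊆ s) :
    ∑ j ∈ s, stateRate α C N p v e j = 1 := by
  by_cases ht : StateTest α C N p v
  · obtain ⟨k, hk⟩ := exists_isSelected (p := p) (v := v) (e := e) ht.nonempty
    simp only [stateRate_of_isSelected ht hk, Finset.sum_ite_eq']
    rw [if_pos (hs (Finset.mem_union_left _ hk.1))]
  · have hN := leastOf_nonempty (v := v) (nonempty_of_not_test ht hne)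
    simp only [stateRate_of_not_test ht]
    rw [← Finset.sum_filter, Finset.sum_const, nsmul_eq_mul, mul_one_div]
    have : s.filter (fun j => j ∈ leastOf N v) = leastOf N v := by
      ext j
      simp only [Finset.mem_filter, and_iff_right_iff_imp]
      exact fun hj => hs (Finset.mem_union_right _ (mem_leastOf.1 hj).1)
    rw [this, div_self]
    exact_mod_cast hN.card_pos.ne'

theorem stateRate_congr {p' v' e' : ℕ → ℝ} (hpC : ∀ j ∈ C, p j = p' j)
    (hvC : ∀ j ∈ C, v j = v' j) (hvN : ∀ j ∈ N, v j = v' j) (heC : ∀ j ∈ C, e j = e' j) (j : ℕ) :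
    stateRate α C N p v e j = stateRate α C N p' v' e' j := by
  have h1 : StateTest α C N p v ↔ StateTest α C N p' v' := by
    refine exists_congr fun k => and_congr_right fun hk => forall₂_congr fun i hi => ?_
    rw [hpC k hk, hvC k hk, hvN i hi]
  have h2 : leastOf N v = leastOf N v' := by
    ext i
    simp only [mem_leastOf]
    refine and_congr_right fun hi => forall₂_congr fun l hl => ?_
    rw [hvN i hi, hvN l hl]
  have h3 : IsSelected C p v e j ↔ IsSelected C p' v' e' j := by
    refine and_congr_right fun hj => and_congr ?_ (and_congr ?_ ?_) <;>
    · refine forall₂_congr fun l hl => ?_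
      rw [hpC j hj, hvC j hj, hpC l hl, hvC l hl]
      try rw [heC j hj, heC l hl]
  classical
  simp only [stateRate, h1, h2, h3]

/-- Following the rates of the hybrid rule for a short while does not change these rates, as long
as the sets `C` and `N` remain the same. -/
theorem eventually_stateRate_eq (α : ℝ) {C N : Finset ℕ} (hCN : Disjoint C N) (p v e : ℕ → ℝ) :
    ∀ᶠ δ in 𝓝[≥] (0 : ℝ), ∀ j,
      stateRate α C N p (fun i => v i + stateRate α C N p v e i * δ) e j =
        stateRate α C N p v e j := by
  set ρ := stateRate α C N p v e with hρ
  by_cases ht : StateTest α C N p v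
  · obtain ⟨k, hk⟩ := exists_isSelected (p := p) (v := v) (e := e) ht.nonempty
    have hρk : ∀ j, ρ j = if j = k then 1 else 0 := stateRate_of_isSelected ht hk
    filter_upwards [self_mem_nhdsWithin] with δ hδ
    rcases (show (0 : ℝ) ≤ δ from hδ).eq_or_lt with rfl | hδ
    · simp [hρ]
    have hkk : ρ k = 1 := by simp [hρk]
    have hkj : ∀ j, j ≠ k → ρ j = 0 := fun j hj => by simp [hρk, hj]
    have hkN : k ∉ N := Finset.disjoint_left.1 hCN hk.1
    have ht' : StateTest α C N p (fun i => v i + ρ i * δ) := by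
      obtain ⟨l, hl, hlN⟩ := ht
      refine ⟨k, hk.1, fun j hj => ?_⟩
      have hjk : j ≠ k := fun h => hkN (h ▸ hj)
      have := hk.2.1 l hl
      have := hlN j hj
      simp only [hkk, hkj j hjk]
      rw [zero_mul, add_zero]
      linarith
    have hk' : IsSelected C p (fun i => v i + ρ i * δ) e k := by
      have hlt : ∀ j ∈ C, j ≠ k → p k - (v k + ρ k * δ) < p j - (v j + ρ j * δ) := by
        intro j hj hjk
        have := hk.2.1 j hj
        rw [hkk, hkj j hjk]; linarith
      refine ⟨hk.1, fun j hj => ?_, fun j hj h => ?_, fun j hj h _ => ?_⟩ <;>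
        rcases eq_or_ne j k with rfl | hjk
      · exact le_rfl
      · exact (hlt j hj hjk).le
      · exact le_rfl
      · exact absurd h (hlt j hj hjk).ne'
      · exact le_rfl
      · exact absurd h (hlt j hj hjk).ne'
    intro j
    rw [stateRate_of_isSelected ht' hk', hρk]
  · have hρj : ∀ j, ρ j = if j ∈ leastOf N v then 1 / ((leastOf N v).card : ℝ) else 0 :=
      stateRate_of_not_test ht
    have hcont : ∀ i, Continuous fun δ : ℝ => v i + ρ i * δ := fun i => by fun_prop
    have h1 : ∀ᶠ δ in 𝓝 (0 : ℝ), ∀ k ∈ C, ∃ j ∈ N,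
        (1 - α) / α * (v j + ρ j * δ) < p k - (v k + ρ k * δ) := by
      rw [Filter.eventually_all_finset]
      intro k hk
      have : ∃ j ∈ N, (1 - α) / α * v j < p k - v k := by
        by_contra! hcon
        exact ht ⟨k, hk, hcon⟩
      obtain ⟨j, hj, hlt⟩ := this
      have : ∀ᶠ δ in 𝓝 (0 : ℝ), (1 - α) / α * (v j + ρ j * δ) < p k - (v k + ρ k * δ) := by
        refine ContinuousAt.eventually_lt (by fun_prop) (by fun_prop) ?_
        simpa using hlt
      exact this.mono fun δ h => ⟨j, hj, h⟩
    have h2 : ∀ᶠ δ in 𝓝 (0 : ℝ), ∀ i ∈ N, ∀ j ∈ N, v j < v i →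
        v j + ρ j * δ < v i + ρ i * δ := by
      rw [Filter.eventually_all_finset]
      intro i hi
      rw [Filter.eventually_all_finset]
      intro j hj
      by_cases h : v j < v i
      · have : ∀ᶠ δ in 𝓝 (0 : ℝ), v j + ρ j * δ < v i + ρ i * δ :=
          ContinuousAt.eventually_lt (by fun_prop) (by fun_prop) (by simpa using h)
        exact this.mono fun δ h _ => h
      · simp [h]
    refine ((h1.and h2).filter_mono nhdsWithin_le_nhds).mono ?_
    rintro δ ⟨h1, h2⟩ j
    have ht' : ¬ StateTest α C N p (fun i => v i + ρ i * δ) := by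
      rintro ⟨k, hk, hkN⟩
      obtain ⟨j, hj, hlt⟩ := h1 k hk
      exact absurd (hkN j hj) (not_le.2 hlt)
    have hL : leastOf N (fun i => v i + ρ i * δ) = leastOf N v := by
      ext j
      simp only [mem_leastOf]
      refine and_congr_right fun hj => ⟨fun h i hi => ?_, fun h i hi => ?_⟩
      · by_contra! hlt
        exact absurd (h i hi) (not_le.2 (h2 j hj i hi hlt))
      · rcases (h i hi).eq_or_lt with heq | hlt
        · have : ρ j = ρ i := by
            rw [hρj, hρj]
            have hjL : j ∈ leastOf N v := mem_leastOf.2 ⟨hj, h⟩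
            have hiL : i ∈ leastOf N v := mem_leastOf.2 ⟨hi, fun l hl => heq ▸ h l hl⟩
            simp [hjL, hiL]
          rw [heq, this]
        · exact (h2 i hi j hj hlt).le
    rw [stateRate_of_not_test ht', hL, hρj]

end State

/-! ### Real-variable preliminaries -/

theorem continuous_induction {P : ℝ → Prop} {a b : ℝ} (hcl : IsClosed {x | P x})
    (h0 : ∀ x ≤ a, P x)
    (step : ∀ x, a ≤ x → x < b → (∀ τ ≤ x, P τ) → ∃ ε > 0, ∀ τ ∈ Icc x (x + ε), P τ) :
    ∀ x ≤ b, P x := by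
  by_contra! hcon
  obtain ⟨x₀, hx₀, hPx₀⟩ := hcon
  set B := {x | ¬ P x} with hB
  have hbdd : BddBelow B := ⟨a, fun x hx => by
    by_contra! h
    exact hx (h0 x h.le)⟩
  have hne : B.Nonempty := ⟨x₀, hPx₀⟩
  have hlt : ∀ τ < sInf B, P τ := fun τ hτ => by
    by_contra h
    exact absurd (csInf_le hbdd h) (not_le.2 hτ)
  have hm : P (sInf B) := by
    have : sInf B ∈ closure {x | P x} := by
      refine closure_mono (show Iio (sInf B) ⊆ {x | P x} from hlt) ?_
      rw [closure_Iio]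
      exact self_mem_Iic
    rwa [hcl.closure_eq] at this
  have hle : ∀ τ ≤ sInf B, P τ := fun τ hτ => by
    rcases hτ.eq_or_lt with rfl | h
    exacts [hm, hlt τ h]
  have hmx : sInf B < x₀ := lt_of_le_of_ne (csInf_le hbdd hPx₀) fun h => hPx₀ (h ▸ hm)
  have ham : a ≤ sInf B := le_csInf hne fun x hx => by
    by_contra! h
    exact hx (h0 x h.le)
  obtain ⟨ε, hε, hstep⟩ := step (sInf B) ham (hmx.trans_le hx₀) hle
  obtain ⟨x, hx, hxlt⟩ := exists_lt_of_csInf_lt hne (show sInf B < sInf B + ε by linarith)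
  exact hx (hstep x ⟨csInf_le hbdd hx, hxlt.le⟩)

theorem sub_le_mul_of_right_deriv_le {f f' : ℝ → ℝ} {a b c : ℝ} (hf : Continuous f)
    (hf' : ∀ t ∈ Ico a b, HasDerivWithinAt f (f' t) (Ici t) t) (hab : a ≤ b)
    (hc : ∀ t ∈ Ico a b, f' t ≤ c) : f b - f a ≤ c * (b - a) := by
  have hB : ∀ x, HasDerivAt (fun x => f a + c * (x - a)) c x := fun x => by
    simpa using (((hasDerivAt_id x).sub_const a).const_mul c).const_add (f a)
  have := image_le_of_deriv_right_le_deriv_boundary (f := f) (f' := f') (a := a) (b := b)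
    (B := fun x => f a + c * (x - a)) (B' := fun _ => c) hf.continuousOn hf'
    (by simp) (by fun_prop) (fun x _ => (hB x).hasDerivWithinAt) hc ⟨hab, le_rfl⟩
  linarith

theorem mul_le_sub_of_le_right_deriv {f f' : ℝ → ℝ} {a b c : ℝ} (hf : Continuous f)
    (hf' : ∀ t ∈ Ico a b, HasDerivWithinAt f (f' t) (Ici t) t) (hab : a ≤ b)
    (hc : ∀ t ∈ Ico a b, c ≤ f' t) : c * (b - a) ≤ f b - f a := by
  have := sub_le_mul_of_right_deriv_le (f := fun t => - f t) (f' := fun t => - f' t) (c := -c)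
    hf.neg (fun t ht => (hf' t ht).neg) hab (fun t ht => neg_le_neg (hc t ht))
  linarith

theorem sInf_eq_of_inter_Iic {A B : Set ℝ} {t : ℝ} (hA : BddBelow A) (hB : BddBelow B)
    (htA : t ∈ A) (h : ∀ τ ≤ t, τ ∈ A ↔ τ ∈ B) : sInf A = sInf B := by
  have key : ∀ {A B : Set ℝ}, BddBelow A → t ∈ A → t ∈ B → (∀ τ ≤ t, τ ∈ B → τ ∈ A) →
      sInf A ≤ sInf B := by
    intro A B hA htA htB h
    refine le_csInf ⟨t, htB⟩ fun b hb => ?_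
    rcases le_total b t with hbt | hbt
    · exact csInf_le hA (h b hbt hb)
    · exact (csInf_le hA htA).trans hbt
  exact le_antisymm (key hA htA ((h t le_rfl).1 htA) fun τ hτ => (h τ hτ).2)
    (key hB ((h t le_rfl).1 htA) htA fun τ hτ => (h τ hτ).1)

/-! ### Trajectories that follow the hybrid rule -/

/-- Job `j` has emitted its signal by time `t` along the trajectory `y`. -/
def HasEmitted (I : Instance) (α : ℝ) (y : ℕ → ℝ → ℝ) (j : ℕ) (t : ℝ) : Prop :=
  j ∈ I.jobs ∧ I.r j ≤ t ∧ α * I.p j ≤ y j t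

open Classical in
/-- The released and unfinished jobs that have emitted their signal. -/
noncomputable def emittedJobs (I : Instance) (α : ℝ) (y : ℕ → ℝ → ℝ) (t : ℝ) : Finset ℕ :=
  {j ∈ I.jobs | HasEmitted I α y j t ∧ y j t < I.p j}

open Classical in
/-- The released jobs that have not emitted their signal. -/
noncomputable def silentJobs (I : Instance) (α : ℝ) (y : ℕ → ℝ → ℝ) (t : ℝ) : Finset ℕ :=
  {j ∈ I.jobs | I.r j ≤ t ∧ ¬ HasEmitted I α y j t}

/-- The rate at which the hybrid rule processes job `j` at time `t` along the trajectory `y`. -/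
noncomputable def rate (I : Instance) (α : ℝ) (y : ℕ → ℝ → ℝ) (t : ℝ) (j : ℕ) : ℝ :=
  stateRate α (emittedJobs I α y t) (silentJobs I α y t) I.p (fun i => y i t)
    (fun i => sInf {τ | HasEmitted I α y i τ}) j

/-- The trajectory `y` follows the hybrid rule until time `b`. -/
structure Follows (I : Instance) (α : ℝ) (y : ℕ → ℝ → ℝ) (b : ℝ) : Prop where
  cont : ∀ j, Continuous (y j)
  zero : ∀ j, ∀ t ≤ 0, y j t = 0
  rule : ∀ t < b, ∃ ε > 0, ∀ j, ∀ s ∈ Icc t (t + ε), y j s = y j t + rate I α y t j * (s - t)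

section Rate

variable {I I' : Instance} {α : ℝ} {y y' : ℕ → ℝ → ℝ} {t : ℝ} {j : ℕ}

theorem mem_emittedJobs : j ∈ emittedJobs I α y t ↔
    j ∈ I.jobs ∧ I.r j ≤ t ∧ α * I.p j ≤ y j t ∧ y j t < I.p j := by
  classical
  rw [emittedJobs, Finset.mem_filter, HasEmitted]; tauto

theorem mem_silentJobs : j ∈ silentJobs I α y t ↔
    j ∈ I.jobs ∧ I.r j ≤ t ∧ y j t < α * I.p j := by
  classical
  rw [silentJobs, Finset.mem_filter, HasEmitted, ← not_le]; tauto

theorem disjoint_emittedJobs_silentJobs (I : Instance) (α : ℝ) (y : ℕ → ℝ → ℝ) (t : ℝ) :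
    Disjoint (emittedJobs I α y t) (silentJobs I α y t) :=
  Finset.disjoint_left.2 fun _ h h' =>
    absurd (mem_emittedJobs.1 h).2.2.1 (not_le.2 (mem_silentJobs.1 h').2.2)

theorem mem_union_jobs (hα : α < 1) : j ∈ emittedJobs I α y t ∪ silentJobs I α y t ↔
    j ∈ I.jobs ∧ I.r j ≤ t ∧ y j t < I.p j := by
  rw [Finset.mem_union, mem_emittedJobs, mem_silentJobs]
  constructor
  · rintro (h | h)
    · exact ⟨h.1, h.2.1, h.2.2.2⟩
    · refine ⟨h.1, h.2.1, h.2.2.trans ?_⟩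
      have := I.p_pos j h.1
      nlinarith
  · rintro ⟨h1, h2, h3⟩
    rcases le_or_gt (α * I.p j) (y j t) with h | h
    · exact Or.inl ⟨h1, h2, h, h3⟩
    · exact Or.inr ⟨h1, h2, h⟩

theorem bddBelow_hasEmitted (I : Instance) (α : ℝ) (y : ℕ → ℝ → ℝ) (j : ℕ) :
    BddBelow {τ | HasEmitted I α y j τ} :=
  ⟨I.r j, fun _ h => h.2.1⟩

theorem rate_nonneg : 0 ≤ rate I α y t j := stateRate_nonneg j

theorem sum_rate_le_one (s : Finset ℕ) : ∑ j ∈ s, rate I α y t j ≤ 1 := sum_stateRate_le_one s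

theorem rate_le_one : rate I α y t j ≤ 1 := by
  simpa using sum_rate_le_one (I := I) (α := α) (y := y) (t := t) {j}

theorem mem_of_rate_ne_zero (hα : α < 1) (h : rate I α y t j ≠ 0) :
    j ∈ I.jobs ∧ I.r j ≤ t ∧ y j t < I.p j :=
  (mem_union_jobs hα).1 (mem_of_stateRate_ne_zero h)

theorem sum_rate_eq_one (hα : α < 1) (hj : j ∈ I.jobs) (hr : I.r j ≤ t) (hy : y j t < I.p j) :
    ∑ i ∈ I.jobs, rate I α y t i = 1 :=
  sum_stateRate_eq_one ⟨j, (mem_union_jobs hα).2 ⟨hj, hr, hy⟩⟩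
    fun _ hi => ((mem_union_jobs hα).1 hi).1

theorem rate_congr
    (hrel : ∀ i, (i ∈ I.jobs ∧ I.r i ≤ t) ↔ (i ∈ I'.jobs ∧ I'.r i ≤ t))
    (hem : ∀ τ ≤ t, ∀ i, HasEmitted I α y i τ ↔ HasEmitted I' α y' i τ)
    (hp : ∀ i, HasEmitted I α y i t → I.p i = I'.p i)
    (hy : ∀ i ∈ I.jobs, I.r i ≤ t → y i t = y' i t) (j : ℕ) :
    rate I α y t j = rate I' α y' t j := by
  have hE : emittedJobs I α y t = emittedJobs I' α y' t := by
    ext i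
    simp only [emittedJobs, Finset.mem_filter]
    constructor
    · rintro ⟨h1, h2, h3⟩
      refine ⟨((hem t le_rfl i).1 h2).1, (hem t le_rfl i).1 h2, ?_⟩
      rwa [← hp i h2, ← hy i h1 h2.2.1]
    · rintro ⟨h1, h2, h3⟩
      have h2' := (hem t le_rfl i).2 h2
      refine ⟨h2'.1, h2', ?_⟩
      rwa [hp i h2', hy i h2'.1 h2'.2.1]
  have hS : silentJobs I α y t = silentJobs I' α y' t := by
    ext i
    simp only [silentJobs, Finset.mem_filter, ← and_assoc]
    rw [hrel i, hem t le_rfl i]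
  unfold rate
  rw [← hE, ← hS]
  refine stateRate_congr ?_ ?_ ?_ ?_ j
  · intro i hi
    obtain ⟨h1, h2, h3, -⟩ := mem_emittedJobs.1 hi
    exact hp i ⟨h1, h2, h3⟩
  · intro i hi
    obtain ⟨h1, h2, h3, -⟩ := mem_emittedJobs.1 hi
    exact hy i h1 h2
  · intro i hi
    obtain ⟨h1, h2, -⟩ := mem_silentJobs.1 hi
    exact hy i h1 h2
  · intro i hi
    obtain ⟨h1, h2, h3, -⟩ := mem_emittedJobs.1 hi
    exact sInf_eq_of_inter_Iic (bddBelow_hasEmitted ..) (bddBelow_hasEmitted ..)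
      (show HasEmitted I α y i t from ⟨h1, h2, h3⟩) fun τ hτ => hem τ hτ i

theorem rate_congr_of_eq (h : ∀ τ ≤ t, ∀ i, y i τ = y' i τ) (j : ℕ) :
    rate I α y t j = rate I α y' t j :=
  rate_congr (fun _ => Iff.rfl) (fun τ hτ i => by simp only [HasEmitted, h τ hτ i])
    (fun _ _ => rfl) (fun i _ _ => h t le_rfl i) j

end Rate

namespace Follows

variable {I I' : Instance} {α b : ℝ} {y y' : ℕ → ℝ → ℝ}

theorem of_le (h : Follows I α y b) {b' : ℝ} (hb : b' ≤ b) : Follows I α y b' :=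
  ⟨h.cont, h.zero, fun t ht => h.rule t (ht.trans_le hb)⟩

theorem hasDerivWithinAt (h : Follows I α y b) {t : ℝ} (ht : t < b) (j : ℕ) :
    HasDerivWithinAt (y j) (rate I α y t j) (Ici t) t := by
  obtain ⟨ε, hε, hrule⟩ := h.rule t ht
  have hlin : HasDerivWithinAt (fun s => y j t + rate I α y t j * (s - t)) (rate I α y t j)
      (Ici t) t := by
    simpa using ((((hasDerivAt_id t).sub_const t).const_mul (rate I α y t j)).const_add
      (y j t)).hasDerivWithinAt (s := Ici t)
  refine hlin.congr_of_eventuallyEq ?_ (by simp)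
  filter_upwards [Icc_mem_nhdsGE (show t < t + ε by linarith)] with s hs using hrule j s hs

theorem mono (h : Follows I α y b) {s t : ℝ} (hst : s ≤ t) (ht : t ≤ b) (j : ℕ) :
    y j s ≤ y j t := by
  have := mul_le_sub_of_le_right_deriv (c := 0) (h.cont j)
    (fun x hx => h.hasDerivWithinAt (hx.2.trans_le ht) j) hst (fun _ _ => rate_nonneg)
  linarith

theorem sub_le (h : Follows I α y b) {s t : ℝ} (hst : s ≤ t) (ht : t ≤ b) (j : ℕ) :
    y j t - y j s ≤ t - s := by
  have := sub_le_mul_of_right_deriv_le (c := 1) (h.cont j)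
    (fun x hx => h.hasDerivWithinAt (hx.2.trans_le ht) j) hst (fun _ _ => rate_le_one)
  linarith

theorem hasDerivWithinAt_sum (h : Follows I α y b) {t : ℝ} (ht : t < b) :
    HasDerivWithinAt (fun s => ∑ j ∈ I.jobs, y j s) (∑ j ∈ I.jobs, rate I α y t j) (Ici t) t :=
  HasDerivWithinAt.fun_sum fun j _ => h.hasDerivWithinAt ht j

theorem sum_sub_le (h : Follows I α y b) {s t : ℝ} (hst : s ≤ t) (ht : t ≤ b) :
    ∑ j ∈ I.jobs, (y j t - y j s) ≤ t - s := by
  have := sub_le_mul_of_right_deriv_le (f := fun s => ∑ j ∈ I.jobs, y j s) (c := 1)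
    (continuous_finsetSum _ fun j _ => h.cont j)
    (fun x hx => h.hasDerivWithinAt_sum (hx.2.trans_le ht)) hst (fun _ _ => sum_rate_le_one _)
  rw [Finset.sum_sub_distrib]
  linarith

/-- While some job is available, the machine is busy. -/
theorem le_sum_sub (h : Follows I α y b) (hα : α < 1) {s t : ℝ} (hst : s ≤ t) (ht : t ≤ b)
    (hbusy : ∀ τ ∈ Ico s t, ∃ j ∈ I.jobs, I.r j ≤ τ ∧ y j τ < I.p j) :
    t - s ≤ ∑ j ∈ I.jobs, (y j t - y j s) := by
  have := mul_le_sub_of_le_right_deriv (f := fun s => ∑ j ∈ I.jobs, y j s) (c := 1)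
    (continuous_finsetSum _ fun j _ => h.cont j)
    (fun x hx => h.hasDerivWithinAt_sum (hx.2.trans_le ht)) hst (fun x hx => by
      obtain ⟨j, hj, hr, hy⟩ := hbusy x hx
      exact (sum_rate_eq_one hα hj hr hy).ge)
  rw [Finset.sum_sub_distrib]
  linarith

theorem nonneg (h : Follows I α y b) {t : ℝ} (ht : t ≤ b) (j : ℕ) : 0 ≤ y j t := by
  rcases le_total t 0 with h0 | h0
  · exact (h.zero j t h0).ge
  · exact (h.zero j 0 le_rfl).symm.le.trans (h.mono h0 ht j)

theorem eq_zero (h : Follows I α y b) (hα : α < 1) {t : ℝ} (ht : t ≤ b) {j : ℕ}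
    (hr : t ≤ I.r j) : y j t = 0 := by
  rcases le_total t 0 with h0 | h0
  · exact h.zero j t h0
  · have := sub_le_mul_of_right_deriv_le (c := 0) (h.cont j)
      (fun x hx => h.hasDerivWithinAt (hx.2.trans_le ht) j) h0 (fun x hx => by
        by_contra! hne
        exact absurd (mem_of_rate_ne_zero hα hne.ne').2.1 (not_le.2 (hx.2.trans_le hr)))
    rw [h.zero j 0 le_rfl] at this
    exact le_antisymm (by linarith) (h.nonneg ht j)

theorem le_p (h : Follows I α y b) (hα : α < 1) {j : ℕ} (hj : j ∈ I.jobs) :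
    ∀ t ≤ b, y j t ≤ I.p j := by
  refine continuous_induction (a := 0) (isClosed_le (h.cont j) continuous_const)
    (fun x hx => ?_) (fun x _ hxb hx => ?_)
  · rw [h.zero j x hx]; exact (I.p_pos j hj).le
  · rcases (hx x le_rfl).eq_or_lt with heq | hlt
    · obtain ⟨ε, hε, hrule⟩ := h.rule x hxb
      refine ⟨ε, hε, fun τ hτ => ?_⟩
      have : rate I α y x j = 0 := by
        by_contra hne
        exact absurd heq (mem_of_rate_ne_zero hα hne).2.2.ne
      rw [hrule j τ hτ, this, heq]; simp
    · have : ∀ᶠ τ in 𝓝[≥] x, y j τ < I.p j :=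
        nhdsWithin_le_nhds ((h.cont j).continuousAt.eventually_lt continuousAt_const hlt)
      obtain ⟨u, hu, hsub⟩ := (mem_nhdsGE_iff_exists_Icc_subset).1 this
      refine ⟨u - x, sub_pos.2 hu, fun τ hτ => ?_⟩
      rw [add_sub_cancel] at hτ
      exact (hsub hτ).le

theorem agree (h : Follows I α y b) (h' : Follows I' α y' b) {J : Set ℕ}
    (hstep : ∀ x < b, (∀ τ ≤ x, ∀ j ∈ J, y j τ = y' j τ) →
      ∀ j ∈ J, rate I α y x j = rate I' α y' x j) :
    ∀ x ≤ b, ∀ j ∈ J, y j x = y' j x := by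
  refine continuous_induction (a := 0) ?_ (fun x hx j _ => ?_) (fun x _ hxb hx => ?_)
  · simp only [ofPred_forall]
    exact isClosed_iInter fun j => isClosed_iInter fun _ => isClosed_eq (h.cont j) (h'.cont j)
  · rw [h.zero j x hx, h'.zero j x hx]
  · obtain ⟨ε, hε, hrule⟩ := h.rule x hxb
    obtain ⟨ε', hε', hrule'⟩ := h'.rule x hxb
    refine ⟨min ε ε', lt_min hε hε', fun τ hτ j hj => ?_⟩
    rw [hrule j τ ⟨hτ.1, hτ.2.trans (by gcongr; exact min_le_left _ _)⟩,
      hrule' j τ ⟨hτ.1, hτ.2.trans (by gcongr; exact min_le_right _ _)⟩,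
      hstep x hxb hx j hj, hx x le_rfl j hj]

theorem unique (h : Follows I α y b) (h' : Follows I α y' b) {x : ℝ} (hx : x ≤ b) (j : ℕ) :
    y j x = y' j x :=
  h.agree h' (J := univ)
    (fun _ _ hag j _ => rate_congr_of_eq (fun τ hτ i => hag τ hτ i (mem_univ i)) j) x hx j
    (mem_univ j)

end Follows

/-! ### Existence of trajectories that follow the rule -/

/-- The trajectory `y` follows the hybrid rule until time `T` and nothing happens afterwards. -/
def FollowsUntil (I : Instance) (α : ℝ) (y : ℕ → ℝ → ℝ) (T : ℝ) : Prop :=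
  Follows I α y T ∧ ∀ j, ∀ t, T ≤ t → y j t = y j T

section Existence

variable {I : Instance} {α T : ℝ} {y : ℕ → ℝ → ℝ}

theorem FollowsUntil.mono (h : FollowsUntil I α y T) (j : ℕ) : Monotone (y j) := by
  intro s t hst
  rcases le_total t T with ht | ht
  · exact h.1.mono hst ht j
  · rw [h.2 j t ht]
    rcases le_total s T with hs | hs
    · exact h.1.mono hs le_rfl j
    · rw [h.2 j s hs]

theorem FollowsUntil.sub_le (h : FollowsUntil I α y T) {s t : ℝ} (hst : s ≤ t) (j : ℕ) :
    y j t - y j s ≤ t - s := by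
  rcases le_total t T with ht | ht
  · exact h.1.sub_le hst ht j
  · rw [h.2 j t ht]
    rcases le_total s T with hs | hs
    · exact (h.1.sub_le hs le_rfl j).trans (by linarith)
    · rw [h.2 j s hs]; linarith

theorem followsUntil_zero (hα : α < 1) : FollowsUntil I α (fun _ _ => 0) 0 := by
  refine ⟨⟨fun _ => continuous_const, fun _ _ _ => rfl, fun t ht => ⟨1, one_pos, ?_⟩⟩,
    fun _ _ _ => rfl⟩
  intro j s _
  have : rate I α (fun _ _ => 0) t j = 0 := by
    by_contra hne
    obtain ⟨h1, h2, -⟩ := mem_of_rate_ne_zero hα hne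
    linarith [I.r_nonneg j h1]
  simp [this]

theorem FollowsUntil.exists_extension (h : FollowsUntil I α y T) (hT : 0 ≤ T) :
    ∃ ε > 0, ∃ y', FollowsUntil I α y' (T + ε) := by
  set ρ := rate I α y T with hρ
  have hev : ∀ᶠ δ in 𝓝[≥] (0 : ℝ),
      (∀ j, stateRate α (emittedJobs I α y T) (silentJobs I α y T) I.p
        (fun i => y i T + ρ i * δ) (fun i => sInf {τ | HasEmitted I α y i τ}) j = ρ j) ∧
      ∀ j ∈ I.jobs, (T < I.r j → T + δ < I.r j) ∧
        (y j T < α * I.p j → y j T + ρ j * δ < α * I.p j) ∧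
        (y j T < I.p j → y j T + ρ j * δ < I.p j) := by
    have hlt : ∀ a b c : ℝ, ∀ᶠ δ in 𝓝[≥] (0 : ℝ), a < c → a + b * δ < c := by
      intro a b c
      by_cases hac : a < c
      · have : ∀ᶠ δ in 𝓝 (0 : ℝ), a + b * δ < c :=
          ContinuousAt.eventually_lt (by fun_prop) continuousAt_const (by simpa using hac)
        exact nhdsWithin_le_nhds (this.mono fun δ h _ => h)
      · simp [hac]
    refine (eventually_stateRate_eq α (disjoint_emittedJobs_silentJobs I α y T) _ _ _).and ?_
    rw [Filter.eventually_all_finset]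
    intro j _
    refine Filter.Eventually.and ?_ ((hlt _ _ _).and (hlt _ _ _))
    simpa using hlt T 1 (I.r j)
  obtain ⟨ε, hε, hsub⟩ := (mem_nhdsGE_iff_exists_Ico_subset).1 hev
  simp only [mem_Ioi] at hε
  set y' : ℕ → ℝ → ℝ := fun j t => y j t + ρ j * max 0 (min t (T + ε) - T) with hy'
  have hbefore : ∀ t ≤ T, ∀ j, y' j t = y j t := by
    intro t ht j
    have : max 0 (min t (T + ε) - T) = 0 := max_eq_left (by linarith [min_le_left t (T + ε)])
    simp [hy', this]
  have hafter : ∀ t ∈ Icc T (T + ε), ∀ j, y' j t = y j T + ρ j * (t - T) := by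
    intro t ht j
    have : max 0 (min t (T + ε) - T) = t - T := by
      rw [min_eq_left ht.2, max_eq_right (by linarith [ht.1])]
    simp [hy', this, h.2 j t ht.1]
  have hrate : ∀ t ∈ Ico T (T + ε), ∀ j, rate I α y' t j = ρ j := by
    intro t ht j
    obtain ⟨hst, hjob⟩ := hsub (show t - T ∈ Ico 0 ε from ⟨by linarith [ht.1], by linarith [ht.2]⟩)
    have hyt : ∀ i, y' i t = y i T + ρ i * (t - T) := hafter t ⟨ht.1, ht.2.le⟩
    have hge : ∀ i, y i T ≤ y' i t := fun i => by
      rw [hyt]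
      have : 0 ≤ ρ i * (t - T) := mul_nonneg rate_nonneg (by linarith [ht.1])
      linarith
    have hrel : ∀ i ∈ I.jobs, (I.r i ≤ t ↔ I.r i ≤ T) := fun i hi => by
      refine ⟨fun hle => ?_, fun hle => hle.trans ht.1⟩
      by_contra! hlt
      linarith [(hjob i hi).1 hlt]
    have hem : ∀ i ∈ I.jobs, (α * I.p i ≤ y' i t ↔ α * I.p i ≤ y i T) := fun i hi => by
      refine ⟨fun hle => ?_, fun hle => hle.trans (hge i)⟩
      by_contra! hlt
      have := (hjob i hi).2.1 hlt
      rw [← hyt] at this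
      linarith
    have hun : ∀ i ∈ I.jobs, (y' i t < I.p i ↔ y i T < I.p i) := fun i hi => by
      refine ⟨fun hlt => (hge i).trans_lt hlt, fun hlt => ?_⟩
      rw [hyt]
      exact (hjob i hi).2.2 hlt
    have hE : emittedJobs I α y' t = emittedJobs I α y T := by
      ext i
      simp only [mem_emittedJobs]
      refine and_congr_right fun hi => ?_
      rw [hrel i hi, hem i hi, hun i hi]
    have hS : silentJobs I α y' t = silentJobs I α y T := by
      ext i
      simp only [mem_silentJobs]
      refine and_congr_right fun hi => ?_
      rw [hrel i hi, ← not_le, ← not_le, hem i hi]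
    rw [← hst j]
    unfold rate
    rw [hE, hS]
    refine stateRate_congr (fun _ _ => rfl) (fun i _ => hyt i) (fun i _ => hyt i) ?_ j
    intro i hi
    obtain ⟨h1, h2, h3, -⟩ := mem_emittedJobs.1 hi
    refine sInf_eq_of_inter_Iic (t := T) (bddBelow_hasEmitted ..) (bddBelow_hasEmitted ..)
      (show HasEmitted I α y' i T from ⟨h1, h2, by rwa [hbefore T le_rfl]⟩) fun τ hτ => ?_
    simp only [HasEmitted, mem_ofPred_eq, hbefore τ hτ]
  refine ⟨ε, hε, y', ⟨fun j => ?_, fun j t ht => ?_, fun t ht => ?_⟩, fun j t ht => ?_⟩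
  · have := h.1.cont j
    fun_prop
  · rw [hbefore t (ht.trans hT), h.1.zero j t ht]
  · rcases lt_or_ge t T with htT | htT
    · obtain ⟨δ, hδ, hrule⟩ := h.1.rule t htT
      refine ⟨min δ (T - t), lt_min hδ (by linarith), fun j s hs => ?_⟩
      have h1 := min_le_left δ (T - t)
      have h2 := min_le_right δ (T - t)
      rw [hbefore s (by linarith [hs.2]), hbefore t htT.le,
        hrule j s ⟨hs.1, by linarith [hs.2]⟩]
      rw [rate_congr_of_eq (y' := y') fun τ hτ i => (hbefore τ (hτ.trans htT.le) i).symm]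
    · refine ⟨T + ε - t, by linarith, fun j s hs => ?_⟩
      rw [hafter s ⟨htT.trans hs.1, by linarith [hs.2]⟩, hafter t ⟨htT, ht.le⟩,
        hrate t ⟨htT, ht⟩]
      ring
  · simp only [hy', min_eq_right ht, min_self]
    rw [h.2 j t (by linarith), h.2 j (T + ε) (by linarith)]

theorem exists_followsUntil_sSup {𝒯 : Set ℝ} (hne : 𝒯.Nonempty) (hb : BddAbove 𝒯)
    (h : ∀ T ∈ 𝒯, ∃ y, FollowsUntil I α y T) : ∃ y, FollowsUntil I α y (sSup 𝒯) := by
  have h' : ∀ T : 𝒯, ∃ y, FollowsUntil I α y T := fun T => h T T.2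
  choose Y hY using h'
  have : Nonempty 𝒯 := hne.to_subtype
  have hag : ∀ (S T : 𝒯) (t : ℝ) (j : ℕ), t ≤ S → t ≤ T → Y S j t = Y T j t := by
    intro S T t j hS hT
    exact ((hY S).1.of_le hS).unique ((hY T).1.of_le hT) le_rfl j
  have hle : ∀ (S T : 𝒯) (t : ℝ) (j : ℕ), t ≤ T → Y S j t ≤ Y T j t := by
    intro S T t j hT
    rcases le_total t S with hS | hS
    · exact (hag S T t j hS hT).le
    · rw [(hY S).2 j t hS, hag S T S j le_rfl (hS.trans hT)]
      exact (hY T).mono j hS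
  have hbd : ∀ (j : ℕ) (t : ℝ), BddAbove (range fun T : 𝒯 => Y T j t) := by
    intro j t
    refine ⟨max t 0, ?_⟩
    rintro _ ⟨T, rfl⟩
    rcases le_total t 0 with h0 | h0
    · simp [(hY T).1.zero j t h0]
    · have := (hY T).sub_le h0 j
      rw [(hY T).1.zero j 0 le_rfl] at this
      exact le_max_of_le_left (by simpa using this)
  set Z : ℕ → ℝ → ℝ := fun j t => ⨆ T : 𝒯, Y T j t with hZ
  have hZY : ∀ (T : 𝒯) (t : ℝ) (j : ℕ), t ≤ T → Z j t = Y T j t := fun T t j ht =>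
    le_antisymm (ciSup_le fun S => hle S T t j ht) (le_ciSup (hbd j t) T)
  refine ⟨Z, ⟨fun j => ?_, fun j t ht => ?_, fun t ht => ?_⟩, fun j t ht => ?_⟩
  · refine (LipschitzWith.of_le_add (f := Z j) fun s t => ?_).continuous
    refine ciSup_le fun T => ?_
    have h1 : Y T j s ≤ Y T j t + dist s t := by
      rcases le_total s t with hst | hst
      · exact ((hY T).mono j hst).trans (by linarith [dist_nonneg (x := s) (y := t)])
      · have := (hY T).sub_le hst j
        rw [Real.dist_eq, abs_of_nonneg (by linarith)]
        linarith
    exact h1.trans (by gcongr; exact le_ciSup (hbd j t) T)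
  · have : ∀ T : 𝒯, Y T j t = 0 := fun T => (hY T).1.zero j t ht
    simp [hZ, this]
  · obtain ⟨T, hT, htT⟩ := exists_lt_of_lt_csSup hne ht
    obtain ⟨ε, hε, hrule⟩ := (hY ⟨T, hT⟩).1.rule t htT
    refine ⟨min ε (T - t), lt_min hε (by linarith), fun j s hs => ?_⟩
    have h1 := min_le_left ε (T - t)
    have h2 := min_le_right ε (T - t)
    rw [hZY ⟨T, hT⟩ s j (by simp only; linarith [hs.2]), hZY ⟨T, hT⟩ t j htT.le,
      hrule j s ⟨hs.1, by linarith [hs.2]⟩,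
      rate_congr_of_eq fun τ hτ i => (hZY ⟨T, hT⟩ τ i (hτ.trans htT.le)).symm]
  · simp only [hZ]
    congr 1
    ext T
    have hT := le_csSup hb T.2
    rw [(hY T).2 j t (hT.trans ht), (hY T).2 j _ hT]

theorem exists_le_followsUntil (I : Instance) (hα : α < 1) (B : ℝ) :
    ∃ T ≥ B, ∃ y, FollowsUntil I α y T := by
  by_contra! hcon
  set 𝒯 := {T : ℝ | 0 ≤ T ∧ ∃ y, FollowsUntil I α y T} with h𝒯
  have h0 : (0 : ℝ) ∈ 𝒯 := ⟨le_rfl, _, followsUntil_zero hα⟩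
  have hb : BddAbove 𝒯 := ⟨B, fun T ⟨_, y, hy⟩ => by
    by_contra! hlt
    exact hcon T hlt.le y hy⟩
  obtain ⟨y, hy⟩ := exists_followsUntil_sSup ⟨0, h0⟩ hb fun T hT => hT.2
  have hsup : 0 ≤ sSup 𝒯 := le_csSup hb h0
  obtain ⟨ε, hε, y', hy'⟩ := hy.exists_extension hsup
  have : sSup 𝒯 + ε ≤ sSup 𝒯 := le_csSup hb ⟨by linarith, y', hy'⟩
  linarith

theorem Follows.eq_p (h : Follows I α y T) (hα : α < 1)
    (hT : ∑ j ∈ I.jobs, (I.r j + I.p j) < T) {j : ℕ} (hj : j ∈ I.jobs) : y j T = I.p j := by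
  refine le_antisymm (h.le_p hα hj T le_rfl) ?_
  by_contra! hlt
  rw [Finset.sum_add_distrib] at hT
  have hp : 0 ≤ ∑ j ∈ I.jobs, I.p j := Finset.sum_nonneg fun j hj => (I.p_pos j hj).le
  have hrj : I.r j ≤ ∑ j ∈ I.jobs, I.r j := Finset.single_le_sum I.r_nonneg hj
  have h1 := h.le_sum_sub hα (s := ∑ j ∈ I.jobs, I.r j) (t := T) (by linarith) le_rfl
    fun τ hτ => ⟨j, hj, hrj.trans hτ.1, (h.mono hτ.2.le le_rfl j).trans_lt hlt⟩
  have h2 : ∑ j ∈ I.jobs, (y j T - y j (∑ j ∈ I.jobs, I.r j)) ≤ ∑ j ∈ I.jobs, I.p j :=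
    Finset.sum_le_sum fun i hi => by
      have := h.le_p hα hi T le_rfl
      have := h.nonneg (t := ∑ j ∈ I.jobs, I.r j) (by linarith) i
      linarith
  linarith

/-- There is a trajectory that follows the hybrid rule forever. -/
theorem exists_follows (I : Instance) (hα : α < 1) :
    ∃ y : ℕ → ℝ → ℝ, ∀ b, Follows I α y b := by
  obtain ⟨T, hT, y, hy⟩ := exists_le_followsUntil I hα (∑ j ∈ I.jobs, (I.r j + I.p j) + 1)
  refine ⟨y, fun b => ⟨hy.1.cont, hy.1.zero, fun t _ => ?_⟩⟩
  rcases lt_or_ge t T with ht | ht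
  · exact hy.1.rule t ht
  · refine ⟨1, one_pos, fun j s hs => ?_⟩
    have : rate I α y t j = 0 := by
      by_contra hne
      obtain ⟨h1, -, h3⟩ := mem_of_rate_ne_zero hα hne
      rw [hy.2 j t ht, hy.1.eq_p hα (by linarith) h1] at h3
      exact lt_irrefl _ h3
    rw [this, hy.2 j s (ht.trans hs.1), hy.2 j t ht]
    simp

end Existence

/-! ### General facts on schedules -/

namespace Schedule

variable {I : Instance} (S : Schedule I) {j : ℕ}

theorem sub_le (hj : j ∈ I.jobs) {s t : ℝ} (hst : s ≤ t) : S.y j t - S.y j s ≤ t - s :=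
  (Finset.single_le_sum (f := fun j => S.y j t - S.y j s)
    (fun i hi => sub_nonneg.2 (S.mono i hi hst)) hj).trans (S.capacity s t hst)

theorem continuous_y (hj : j ∈ I.jobs) : Continuous (S.y j) := by
  refine (LipschitzWith.of_le_add (f := S.y j) fun s t => ?_).continuous
  rcases le_total s t with hst | hst
  · exact (S.mono j hj hst).trans (by linarith [dist_nonneg (x := s) (y := t)])
  · have := S.sub_le hj hst
    rw [Real.dist_eq, abs_of_nonneg (by linarith)]
    linarith

theorem nonneg (hj : j ∈ I.jobs) (t : ℝ) : 0 ≤ S.y j t := by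
  rcases le_total t (I.r j) with h | h
  · exact (S.eq_zero j hj t h).ge
  · exact (S.eq_zero j hj (I.r j) le_rfl).symm.le.trans (S.mono j hj h)

theorem completion_mem (hj : j ∈ I.jobs) :
    S.completion j ∈ {t : ℝ | I.r j ≤ t ∧ S.y j t = I.p j} := by
  refine IsClosed.csInf_mem ?_ ?_ ⟨I.r j, fun t ht => ht.1⟩
  · exact (isClosed_Ici (a := I.r j)).inter (isClosed_eq (S.continuous_y hj) continuous_const)
  · obtain ⟨t, ht⟩ := S.completes j hj
    refine ⟨t, ?_, ht⟩
    by_contra! hlt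
    have := S.eq_zero j hj t hlt.le
    linarith [I.p_pos j hj]

theorem lt_completion_iff (hj : j ∈ I.jobs) {t : ℝ} (hr : I.r j ≤ t) :
    t < S.completion j ↔ S.y j t < I.p j := by
  constructor
  · intro h
    refine lt_of_le_of_ne (S.le_p j hj t) fun heq => ?_
    exact absurd (csInf_le ⟨I.r j, fun t ht => ht.1⟩
      (show t ∈ {t : ℝ | I.r j ≤ t ∧ S.y j t = I.p j} from ⟨hr, heq⟩))
      (not_le.2 h)
  · intro h
    by_contra! hle
    have := S.mono j hj hle
    rw [(S.completion_mem hj).2] at this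
    linarith

theorem mem_available {t : ℝ} : j ∈ S.available t ↔ j ∈ I.jobs ∧ I.r j ≤ t ∧ S.y j t < I.p j := by
  classical
  rw [available, Finset.mem_filter]
  exact and_congr_right fun hj => and_congr_right fun hr => S.lt_completion_iff hj hr

theorem clairvoyant_eq (α t : ℝ) : S.clairvoyant α t = emittedJobs I α S.y t := by
  classical
  ext j
  rw [clairvoyant, Finset.mem_filter, mem_available, mem_emittedJobs, Emitted]
  tauto

theorem nonclairvoyant_eq {α : ℝ} (hα : α < 1) (t : ℝ) :
    S.nonclairvoyant α t = silentJobs I α S.y t := by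
  classical
  ext j
  rw [nonclairvoyant, Finset.mem_filter, mem_available, mem_silentJobs, Emitted]
  constructor
  · rintro ⟨⟨h1, h2, -⟩, h⟩
    exact ⟨h1, h2, not_le.1 fun h3 => h ⟨h1, h2, h3⟩⟩
  · rintro ⟨h1, h2, h3⟩
    have := I.p_pos j h1
    exact ⟨⟨h1, h2, by nlinarith⟩, fun h => absurd h.2.2 (not_le.2 h3)⟩

/-- A schedule whose trajectory follows the hybrid rule is a hybrid schedule. -/
theorem isHybrid_of_follows {α : ℝ} (hα : α < 1) (h : ∀ b, Follows I α S.y b) :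
    S.IsHybrid α := by
  intro t
  have hd := (h (t + 1)).hasDerivWithinAt (lt_add_one t)
  have htest : S.SRPTTest α t ↔
      StateTest α (emittedJobs I α S.y t) (silentJobs I α S.y t) I.p (fun i => S.y i t) := by
    unfold SRPTTest StateTest
    rw [clairvoyant_eq, nonclairvoyant_eq S hα]
    rfl
  rw [htest]
  refine ⟨fun ht => ?_, fun ht j _ => ?_⟩
  · obtain ⟨k, hk⟩ := exists_isSelected (p := I.p) (v := fun i => S.y i t)
      (e := fun i => sInf {τ | HasEmitted I α S.y i τ}) ht.nonempty
    unfold RunsSRPT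
    rw [clairvoyant_eq]
    refine ⟨k, hk.1, hk.2.1, hk.2.2.1, fun j _ => ?_⟩
    have := hd j
    rwa [rate, stateRate_of_isSelected ht hk] at this
  · have hL : S.leastProcessed α t = leastOf (silentJobs I α S.y t) (fun i => S.y i t) := by
      unfold leastProcessed leastOf
      rw [nonclairvoyant_eq S hα]
    have := hd j
    rw [rate, stateRate_of_not_test ht] at this
    rw [hL]
    exact this

end Schedule

/-! ### The hybrid algorithm -/

/-- The hybrid algorithm, with ties broken in favour of smaller names. -/
noncomputable def hybrid {α : ℝ} (hα : α < 1) : Algorithm := fun I =>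
  have h := (exists_follows I hα).choose_spec
  { y := (exists_follows I hα).choose
    mono := fun j _ _ t hst => (h t).mono hst le_rfl j
    eq_zero := fun _ _ t ht => (h t).eq_zero hα le_rfl ht
    le_p := fun _ hj t => (h t).le_p hα hj t le_rfl
    capacity := fun _ t hst => (h t).sum_sub_le hst le_rfl
    completes := fun _ hj => ⟨_, (h _).eq_p hα (lt_add_one _) hj⟩ }

theorem hybrid_follows {α : ℝ} (hα : α < 1) (I : Instance) (b : ℝ) :
    Follows I α (hybrid hα I).y b :=
  (exists_follows I hα).choose_spec b

theorem hybrid_isClairvoyantOnline {α : ℝ} (hα : α < 1) :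
    (hybrid hα).IsClairvoyantOnline α := by
  intro I I' t hinfo j hj hr
  refine (hybrid_follows hα I t).agree (hybrid_follows hα I' t) (J := {i | i ∈ I.jobs ∧ I.r i ≤ t})
    (fun x hx hag i _ => ?_) t le_rfl j ⟨hj, hr⟩
  exact rate_congr (fun l => (hinfo x hx.le l).1)
    (fun τ hτ l => (hinfo τ (hτ.trans hx.le) l).2.1) (fun l => (hinfo x hx.le l).2.2)
    (fun l hl hlx => hag x le_rfl l ⟨hl, hlx.trans hx.le⟩) i

/-! ### Priorities -/

/-- The remaining processing time of a job of length `p` that has been processed for `x` units, if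
it has emitted its signal, and otherwise what would remain if it emitted its signal now. -/
noncomputable def priority (α p x : ℝ) : ℝ :=
  if α = 0 then p - x else min ((1 - α) / α * x) (p - x)

section Priority

variable {α p x : ℝ}

theorem continuous_priority (α p : ℝ) : Continuous (priority α p) := by
  unfold priority
  split_ifs <;> fun_prop

theorem priority_le : priority α p x ≤ p - x := by
  unfold priority
  split_ifs
  exacts [le_rfl, min_le_right _ _]

theorem priority_of_emitted (h0 : 0 ≤ α) (h : α * p ≤ x) : priority α p x = p - x := by
  unfold priority
  split_ifs with hα
  · rfl
  · have : 0 < α := lt_of_le_of_ne h0 (Ne.symm hα)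
    refine min_eq_right ?_
    rw [div_mul_eq_mul_div, le_div_iff₀ this]
    linarith

theorem priority_of_le (h0 : 0 < α) (h : x ≤ α * p) : priority α p x = (1 - α) / α * x := by
  rw [priority, if_neg h0.ne']
  refine min_eq_left ?_
  rw [div_mul_eq_mul_div, div_le_iff₀ h0]
  linarith

end Priority

section Processing

variable {I : Instance} {α b t : ℝ} {y : ℕ → ℝ → ℝ} {i j : ℕ}

theorem Follows.pos_of_silent (h : Follows I α y b) (h0 : 0 ≤ α) (ht : t ≤ b)
    (hj : y j t < α * I.p j) : 0 < α := by
  refine lt_of_le_of_ne h0 fun hα => ?_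
  have := h.nonneg ht j
  rw [← hα, zero_mul] at hj
  linarith

/-- The hybrid rule processes available jobs of smallest priority. -/
theorem Follows.priority_le_of_rate_ne_zero (h : Follows I α y b) (h0 : 0 ≤ α) (hα : α < 1)
    (ht : t ≤ b) (hj : rate I α y t j ≠ 0) (hi : i ∈ I.jobs) (hr : I.r i ≤ t)
    (hy : y i t < I.p i) : priority α (I.p j) (y j t) ≤ priority α (I.p i) (y i t) := by
  have hem : ∀ l ∈ emittedJobs I α y t, priority α (I.p l) (y l t) = I.p l - y l t := fun l hl =>
    priority_of_emitted h0 (mem_emittedJobs.1 hl).2.2.1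
  have hsi : ∀ l ∈ silentJobs I α y t, priority α (I.p l) (y l t) = (1 - α) / α * y l t :=
    fun l hl => by
      have hlt := (mem_silentJobs.1 hl).2.2
      exact priority_of_le (h.pos_of_silent h0 ht hlt) hlt.le
  have hi' := (mem_union_jobs hα).2 ⟨hi, hr, hy⟩
  have hc : 0 ≤ (1 - α) / α := div_nonneg (by linarith) h0
  by_cases htest : StateTest α (emittedJobs I α y t) (silentJobs I α y t) I.p (fun i => y i t)
  · obtain ⟨k, hk⟩ := exists_isSelected (p := I.p) (v := fun i => y i t)
      (e := fun i => sInf {τ | HasEmitted I α y i τ}) htest.nonempty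
    have hjk : j = k := by
      by_contra hne
      rw [rate, stateRate_of_isSelected htest hk, if_neg hne] at hj
      exact hj rfl
    subst hjk
    rw [hem j hk.1]
    rcases Finset.mem_union.1 hi' with hi' | hi'
    · rw [hem i hi']; exact hk.2.1 i hi'
    · rw [hsi i hi']
      obtain ⟨l, hl, hlN⟩ := htest
      exact (hk.2.1 l hl).trans (hlN i hi')
  · have hjL : j ∈ leastOf (silentJobs I α y t) (fun i => y i t) := by
      by_contra hne
      rw [rate, stateRate_of_not_test htest, if_neg hne] at hj
      exact hj rfl
    rw [mem_leastOf] at hjL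
    rw [hsi j hjL.1]
    rcases Finset.mem_union.1 hi' with hi' | hi'
    · rw [hem i hi']
      have : ∃ l ∈ silentJobs I α y t, (1 - α) / α * y l t < I.p i - y i t := by
        by_contra! hcon
        exact htest ⟨i, hi', hcon⟩
      obtain ⟨l, hl, hlt⟩ := this
      exact (mul_le_mul_of_nonneg_left (hjL.2 l hl) hc).trans hlt.le
    · rw [hsi i hi']
      exact mul_le_mul_of_nonneg_left (hjL.2 i hi') hc

theorem eq_of_rate_ne_zero (hj : rate I α y t j ≠ 0) (hem : α * I.p j ≤ y j t)
    (hi : rate I α y t i ≠ 0) : i = j := by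
  by_cases htest : StateTest α (emittedJobs I α y t) (silentJobs I α y t) I.p (fun i => y i t)
  · obtain ⟨k, hk⟩ := exists_isSelected (p := I.p) (v := fun i => y i t)
      (e := fun i => sInf {τ | HasEmitted I α y i τ}) htest.nonempty
    have key : ∀ l, rate I α y t l ≠ 0 → l = k := by
      intro l hl
      by_contra hne
      rw [rate, stateRate_of_isSelected htest hk, if_neg hne] at hl
      exact hl rfl
    rw [key i hi, key j hj]
  · exfalso
    have hjL : j ∈ leastOf (silentJobs I α y t) (fun i => y i t) := by
      by_contra hne
      rw [rate, stateRate_of_not_test htest, if_neg hne] at hj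
      exact hj rfl
    exact absurd hem (not_le.2 (mem_silentJobs.1 (mem_leastOf.1 hjL).1).2.2)

/-- A job passes through every intermediate amount of processing while being processed. -/
theorem Follows.exists_rate_ne_zero (h : Follows I α y b) {a v : ℝ} (hab : a ≤ b)
    (hva : y j a ≤ v) (hvb : v < y j b) : ∃ τ ∈ Ico a b, y j τ = v ∧ rate I α y τ j ≠ 0 := by
  obtain ⟨c, hc, hcv⟩ := intermediate_value_Icc hab (h.cont j).continuousOn ⟨hva, hvb.le⟩
  have hcomp : IsCompact (Icc c b ∩ {τ | y j τ ≤ v}) :=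
    isCompact_Icc.inter_right (isClosed_le (h.cont j) continuous_const)
  obtain ⟨τ, ⟨hτ, hτv⟩, hmax⟩ := hcomp.exists_isGreatest ⟨c, ⟨le_rfl, hc.2⟩, hcv.le⟩
  have hτb : τ < b := lt_of_le_of_ne hτ.2 fun heq => by
    subst heq
    exact absurd hτv (not_le.2 hvb)
  refine ⟨τ, ⟨hc.1.trans hτ.1, hτb⟩, le_antisymm hτv (hcv ▸ h.mono hτ.1 hτ.2 j), fun h0 => ?_⟩
  obtain ⟨ε, hε, hrule⟩ := h.rule τ hτb
  have hlt : τ < min (τ + ε) b := lt_min (by linarith) hτb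
  have hmem : min (τ + ε) b ∈ Icc c b ∩ {τ | y j τ ≤ v} := by
    refine ⟨⟨hτ.1.trans hlt.le, min_le_right _ _⟩, ?_⟩
    show y j (min (τ + ε) b) ≤ v
    rw [hrule j _ ⟨hlt.le, min_le_left _ _⟩, h0]
    simpa using hτv
  exact absurd (hmax hmem) (not_le.2 hlt)

/-- For every threshold `h` there is a time `s` such that, until time `t`, the machine has been
busy with jobs released after `s`, each of which has received little processing, and with at most
one older job, whose remaining processing time was `h` at time `s`. -/
theorem Follows.exists_threshold_time (hf : Follows I α y t) (h0 : 0 ≤ α) (hα : α < 1) {h : ℝ}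
    (hh : 0 < h) : ∃ s ≤ t, ∃ A ⊆ I.jobs, ∃ B ⊆ I.jobs, Disjoint A B ∧ B.card ≤ 1 ∧
      t - s ≤ ∑ j ∈ I.jobs, (y j t - y j s) ∧
      (∀ j ∈ A, s ≤ I.r j ∧ I.r j ≤ t ∧ (1 - α) * y j t ≤ h) ∧
      (∀ j ∈ B, I.p j - y j s = h) ∧
      ∀ j ∈ I.jobs, j ∉ A → j ∉ B →
        y j t = y j s ∧ (I.r j ≤ t → y j t < I.p j → h ≤ I.p j - y j t) := by
  classical
  set P : Set ℝ := {τ | τ ≤ t ∧ ∀ j ∈ I.jobs, I.r j ≤ τ → y j τ < I.p j →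
    h ≤ priority α (I.p j) (y j τ)} with hP
  have hbdd : BddAbove P := ⟨t, fun τ hτ => hτ.1⟩
  have hne : P.Nonempty := by
    refine ⟨min t (-1), min_le_left _ _, fun j hj hr => ?_⟩
    linarith [I.r_nonneg j hj, min_le_right t (-1)]
  set s := sSup P with hs
  have hst : s ≤ t := csSup_le hne fun τ hτ => hτ.1
  -- a job processed with priority at least `h` witnesses membership in `P`
  have hmemP : ∀ j τ, τ ≤ t → rate I α y τ j ≠ 0 → h ≤ priority α (I.p j) (y j τ) → τ ∈ P :=
    fun j τ hτ hr hp => ⟨hτ, fun i hi hri hyi =>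
      hp.trans (hf.priority_le_of_rate_ne_zero h0 hα hτ hr hi hri hyi)⟩
  have hleP : ∀ τ ∈ P, τ ≤ s := fun τ hτ => le_csSup hbdd hτ
  set A := I.jobs.filter fun j => (s < I.r j ∨ (s = I.r j ∧ s ∉ P)) ∧ I.r j ≤ t with hA
  set B := I.jobs.filter fun j => j ∉ A ∧ y j s < y j t with hB
  have hold : ∀ j ∈ I.jobs, j ∉ A → I.r j ≤ t → I.r j ≤ s ∧ (y j s < I.p j →
      h ≤ priority α (I.p j) (y j s)) := by
    intro j hj hjA hjt
    simp only [hA, Finset.mem_filter, hj, hjt, true_and, and_true, not_or, not_and, not_lt,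
      not_not] at hjA
    refine ⟨hjA.1, fun hlt => ?_⟩
    rcases hjA.1.eq_or_lt with heq | hrs
    · exact (hjA.2 heq.symm).2 j hj hjA.1 hlt
    · have hcl : s ∈ closure (P ∩ Ioi (I.r j)) := by
        rw [mem_closure_iff]
        intro o ho hso
        obtain ⟨l, u, ⟨hl, hu⟩, hsub⟩ := (mem_nhds_iff_exists_Ioo_subset).1 (ho.mem_nhds hso)
        obtain ⟨τ, hτ, hlτ⟩ := exists_lt_of_lt_csSup hne (max_lt hl hrs)
        exact ⟨τ, hsub ⟨(le_max_left _ _).trans_lt hlτ, (hleP τ hτ).trans_lt hu⟩, hτ,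
          (le_max_right _ _).trans_lt hlτ⟩
      have hclosed : IsClosed {τ | h ≤ priority α (I.p j) (y j τ)} :=
        isClosed_le continuous_const ((continuous_priority _ _).comp (hf.cont j))
      refine (closure_minimal ?_ hclosed) hcl
      rintro τ ⟨hτ, hτr⟩
      exact hτ.2 j hj (le_of_lt hτr) ((hf.mono (hleP τ hτ) hst j).trans_lt hlt)
  have hBkey : ∀ j ∈ B, rate I α y s j ≠ 0 ∧ α * I.p j ≤ y j s ∧ I.p j - y j s = h := by
    intro j hjB
    simp only [hB, Finset.mem_filter] at hjB
    obtain ⟨hj, hjA, hlt⟩ := hjB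
    have hjt : I.r j ≤ t := by
      by_contra! hlt'
      rw [hf.eq_zero hα le_rfl hlt'.le, hf.eq_zero hα hst (hst.trans hlt'.le)] at hlt
      exact lt_irrefl _ hlt
    have hqs := (hold j hj hjA hjt).2 (hlt.trans_le (hf.le_p hα hj t le_rfl))
    have hsmall : ∀ v ∈ Ioo (y j s) (y j t), priority α (I.p j) v < h := by
      intro v hv
      by_contra! hge
      obtain ⟨τ, hτ, hτv, hτr⟩ := hf.exists_rate_ne_zero hst hv.1.le hv.2
      have hτP := hmemP j τ hτ.2.le hτr (by rwa [hτv])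
      have : τ = s := le_antisymm (hleP τ hτP) hτ.1
      rw [this] at hτv
      exact hv.1.ne hτv
    have hqle : priority α (I.p j) (y j s) ≤ h := by
      have hcl : y j s ∈ closure (Ioo (y j s) (y j t)) := by
        rw [closure_Ioo hlt.ne]; exact ⟨le_rfl, hlt.le⟩
      exact closure_minimal (s := Ioo (y j s) (y j t)) (t := {v | priority α (I.p j) v ≤ h})
        (fun v hv => (hsmall v hv).le)
        (isClosed_le (continuous_priority _ _) continuous_const) hcl
    have hem : α * I.p j ≤ y j s := by
      by_contra! hsil
      have hαpos := hf.pos_of_silent h0 hst hsil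
      obtain ⟨v, hv, hv'⟩ := exists_between (lt_min hlt hsil)
      have h1 := hsmall v ⟨hv, hv'.trans_le (min_le_left _ _)⟩
      rw [priority_of_le hαpos (hv'.trans_le (min_le_right _ _)).le] at h1
      rw [priority_of_le hαpos hsil.le] at hqs
      have : 0 < (1 - α) / α := div_pos (by linarith) hαpos
      nlinarith
    refine ⟨?_, hem, ?_⟩
    · obtain ⟨τ, hτ, hτv, hτr⟩ := hf.exists_rate_ne_zero hst le_rfl hlt
      have hτP := hmemP j τ hτ.2.le hτr (by rwa [hτv])
      have : τ = s := le_antisymm (hleP τ hτP) hτ.1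
      rwa [this] at hτr
    · rw [← priority_of_emitted h0 hem]
      exact le_antisymm hqle hqs
  refine ⟨s, hst, A, Finset.filter_subset _ _, B, Finset.filter_subset _ _, ?_, ?_, ?_, ?_,
    fun j hj => (hBkey j hj).2.2, ?_⟩
  · exact Finset.disjoint_left.2 fun j hjA hjB => (Finset.mem_filter.1 hjB).2.1 hjA
  · refine Finset.card_le_one.2 fun i hi j hj => ?_
    exact eq_of_rate_ne_zero (hBkey j hj).1 (hBkey j hj).2.1 (hBkey i hi).1
  · refine le_of_forall_pos_le_add fun ε hε => ?_
    rcases le_or_gt t (s + ε) with hle | hlt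
    · have : 0 ≤ ∑ j ∈ I.jobs, (y j t - y j s) :=
        Finset.sum_nonneg fun j _ => sub_nonneg.2 (hf.mono hst le_rfl j)
      linarith
    · have h1 := hf.le_sum_sub hα hlt.le le_rfl fun τ hτ => by
        by_contra! hcon
        have : τ ∈ P := ⟨hτ.2.le, fun j hj hr hy => absurd hy (not_lt.2 (hcon j hj hr))⟩
        linarith [hleP τ this, hτ.1]
      have h2 : ∑ j ∈ I.jobs, (y j t - y j (s + ε)) ≤ ∑ j ∈ I.jobs, (y j t - y j s) :=
        Finset.sum_le_sum fun j _ =>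
          sub_le_sub_left (hf.mono (show s ≤ s + ε by linarith) hlt.le j) _
      linarith
  · intro j hjA
    simp only [hA, Finset.mem_filter] at hjA
    obtain ⟨hj, hsr, hrt⟩ := hjA
    refine ⟨hsr.elim le_of_lt fun h => h.1.le, hrt, ?_⟩
    by_contra! hlt
    have hβ : 0 < 1 - α := by linarith
    have hyp := hf.le_p hα hj t le_rfl
    have hdiv : h / (1 - α) < y j t := (div_lt_iff₀ hβ).2 (by linarith)
    have hdiv0 : 0 < h / (1 - α) := div_pos hh hβ
    set v := α * (h / (1 - α)) with hv
    have hv0 : 0 ≤ v := by positivity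
    have hvp : v ≤ α * I.p j := mul_le_mul_of_nonneg_left (hdiv.le.trans hyp) h0
    have hvy : v < y j t := lt_of_le_of_lt (by nlinarith) hdiv
    have hpv : h ≤ priority α (I.p j) v := by
      rcases h0.eq_or_lt with hz | hpos
      · have hv' : v = 0 := by rw [hv, ← hz, zero_mul]
        rw [priority, if_pos hz.symm, hv', sub_zero]
        rw [← hz] at hlt
        linarith
      · rw [priority_of_le hpos hvp, hv]
        refine le_of_eq ?_
        field_simp
    obtain ⟨τ, hτ, hτv, hτr⟩ := hf.exists_rate_ne_zero hrt
      ((hf.eq_zero hα hrt le_rfl).trans_le hv0) hvy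
    have hτP := hmemP j τ hτ.2.le hτr (by rwa [hτv])
    have hτs := hleP τ hτP
    rcases hsr with hsr | ⟨heq, hsP⟩
    · linarith [hτ.1]
    · have : τ = s := le_antisymm hτs (heq ▸ hτ.1)
      exact hsP (this ▸ hτP)
  · intro j hj hjA hjB
    have heq : y j t = y j s := by
      refine le_antisymm ?_ (hf.mono hst le_rfl j)
      by_contra! hlt
      exact hjB (Finset.mem_filter.2 ⟨hj, hjA, hlt⟩)
    refine ⟨heq, fun hr hlt => ?_⟩
    rw [heq] at hlt ⊢
    exact ((hold j hj hjA hr).2 hlt).trans priority_le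

end Processing

/-! ### Local competitiveness -/

theorem card_le_card_add_one {ι κ : Type*} (a : ι → ℝ) (b : κ → ℝ) (R : Finset κ) :
    ∀ J : Finset ι, (∀ j ∈ J, 0 < a j) →
      (∀ j ∈ J, ∑ i ∈ J with a i ≤ a j, a i ≤ ∑ i ∈ R with b i ≤ a j, b i + a j) →
      J.card ≤ R.card + 1 := by
  classical
  induction R using Finset.induction_on with
  | empty =>
    intro J hpos hJ
    rw [Finset.card_empty, zero_add, Finset.card_le_one]
    by_contra! hcon
    obtain ⟨i, hi, j, hj, hij⟩ := hcon
    have key : ∀ i ∈ J, ∀ j ∈ J, i ≠ j → ¬ a i ≤ a j := by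
      intro i hi j hj hij hle
      have h1 := hJ j hj
      have h2 : ∑ l ∈ {i, j}, a l ≤ ∑ l ∈ J with a l ≤ a j, a l := by
        refine Finset.sum_le_sum_of_subset_of_nonneg ?_
          fun l hl _ => (hpos l (Finset.mem_filter.1 hl).1).le
        intro l hl
        rcases Finset.mem_insert.1 hl with rfl | hl
        · exact Finset.mem_filter.2 ⟨hi, hle⟩
        · rw [Finset.mem_singleton.1 hl]
          exact Finset.mem_filter.2 ⟨hj, le_rfl⟩
      rw [Finset.sum_pair hij] at h2
      simp only [Finset.filter_empty, Finset.sum_empty, zero_add] at h1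
      linarith [hpos i hi]
    exact (le_total (a i) (a j)).elim (key i hi j hj hij) (key j hj i hi hij.symm)
  | insert m R hm ih =>
    intro J hpos hJ
    rw [Finset.card_insert_of_notMem hm]
    by_cases hex : (J.filter fun j => b m ≤ a j).Nonempty
    · obtain ⟨k, hk, hkmin⟩ := Finset.exists_min_image _ a hex
      rw [Finset.mem_filter] at hk
      have := ih (J.erase k) (fun j hj => hpos j (Finset.mem_of_mem_erase hj)) fun j hj => by
        obtain ⟨hjk, hj⟩ := Finset.mem_erase.1 hj
        have hjJ := hJ j hj
        rw [Finset.filter_insert] at hjJ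
        rw [Finset.filter_erase]
        by_cases hbj : b m ≤ a j
        · have hkj := hkmin j (Finset.mem_filter.2 ⟨hj, hbj⟩)
          have hkmem : k ∈ J.filter fun i => a i ≤ a j := Finset.mem_filter.2 ⟨hk.1, hkj⟩
          rw [if_pos hbj, Finset.sum_insert (by simp [hm])] at hjJ
          have := Finset.add_sum_erase _ a hkmem
          linarith [hk.2]
        · rw [if_neg hbj] at hjJ
          rwa [Finset.erase_eq_of_notMem]
          simp only [Finset.mem_filter, not_and]
          exact fun _ hle => hbj (hk.2.trans hle)
      have := Finset.card_erase_add_one hk.1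
      omega
    · have := ih J hpos fun j hj => by
        have hjJ := hJ j hj
        rwa [Finset.filter_insert, if_neg] at hjJ
        exact fun hle => hex ⟨j, Finset.mem_filter.2 ⟨hj, hle⟩⟩
      omega

section Local

variable {I : Instance} {α t : ℝ}

open Classical in
theorem sum_rem_le (S S' : Schedule I) (h0 : 0 ≤ α) (hα : α < 1) (hf : Follows I α S.y t) {h : ℝ}
    (hh : 0 < h) :
    ∑ j ∈ S.available t \ S'.available t with S.rem j t < h, S.rem j t ≤
      ∑ i ∈ S'.available t with (1 - α) * S.y i t ≤ h, S.y i t +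
        if ∃ k ∈ I.jobs, h ≤ I.p k then h else 0 := by
  obtain ⟨s, hst, A, hAI, B, hBI, hAB, hBcard, hwork, hA, hB, hold⟩ :=
    hf.exists_threshold_time h0 hα hh
  set R := S'.available t with hR
  have hrem : ∀ j ∈ I.jobs, 0 ≤ S.rem j t := fun j hj => sub_nonneg.2 (S.le_p j hj t)
  -- the other schedule completes the jobs of `A` outside `R` after time `s`
  have hopt : ∑ j ∈ A \ R, I.p j ≤ t - s := by
    refine le_trans ?_ (S'.capacity s t hst)
    refine le_trans (Finset.sum_le_sum fun j hj => ?_)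
      (Finset.sum_le_sum_of_subset_of_nonneg (Finset.sdiff_subset.trans hAI)
        fun j hj _ => sub_nonneg.2 (S'.mono j hj hst))
    obtain ⟨hjA, hjR⟩ := Finset.mem_sdiff.1 hj
    obtain ⟨h1, h2, -⟩ := hA j hjA
    rw [S'.eq_zero j (hAI hjA) s h1, sub_zero]
    by_contra! hlt
    exact hjR (S'.mem_available.2 ⟨hAI hjA, h2, hlt⟩)
  have hsplit : ∑ j ∈ I.jobs, (S.y j t - S.y j s) =
      ∑ j ∈ A, S.y j t + ∑ j ∈ B, (h - S.rem j t) := by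
    rw [← Finset.sum_subset (Finset.union_subset hAI hBI), Finset.sum_union hAB]
    · congr 1
      · refine Finset.sum_congr rfl fun j hj => ?_
        rw [S.eq_zero j (hAI hj) s (hA j hj).1, sub_zero]
      · refine Finset.sum_congr rfl fun j hj => ?_
        have := hB j hj
        unfold Schedule.rem
        linarith
    · intro j hj hjAB
      rw [Finset.mem_union, not_or] at hjAB
      rw [(hold j hj hjAB.1 hjAB.2).1, sub_self]
  have hA2 : ∑ j ∈ A, S.y j t = ∑ j ∈ A \ R, S.y j t + ∑ j ∈ A ∩ R, S.y j t := by
    rw [add_comm, Finset.sum_inter_add_sum_sdiff]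
  have hAR : ∑ j ∈ A \ R, S.rem j t = ∑ j ∈ A \ R, I.p j - ∑ j ∈ A \ R, S.y j t := by
    simp only [Schedule.rem, Finset.sum_sub_distrib]
  have hBsum : ∑ j ∈ B, (h - S.rem j t) = B.card * h - ∑ j ∈ B, S.rem j t := by
    rw [Finset.sum_sub_distrib, Finset.sum_const, nsmul_eq_mul]
  have hleft : ∑ j ∈ S.available t \ R with S.rem j t < h, S.rem j t ≤
      ∑ j ∈ A \ R, S.rem j t + ∑ j ∈ B, S.rem j t := by
    rw [← Finset.sum_union (hAB.mono_left Finset.sdiff_subset)]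
    refine Finset.sum_le_sum_of_subset_of_nonneg (fun j hj => ?_) fun j hj _ => ?_
    · rw [Finset.mem_filter, Finset.mem_sdiff, S.mem_available] at hj
      obtain ⟨⟨⟨hjI, hjr, hjp⟩, hjR⟩, hjh⟩ := hj
      by_contra hcon
      simp only [Finset.mem_union, Finset.mem_sdiff, hjR, not_false_eq_true, and_true,
        not_or] at hcon
      exact absurd ((hold j hjI hcon.1 hcon.2).2 hjr hjp) (not_le.2 hjh)
    · rcases Finset.mem_union.1 hj with hj | hj
      · exact hrem j (hAI (Finset.mem_sdiff.1 hj).1)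
      · exact hrem j (hBI hj)
  have hright : ∑ j ∈ A ∩ R, S.y j t ≤ ∑ i ∈ R with (1 - α) * S.y i t ≤ h, S.y i t := by
    refine Finset.sum_le_sum_of_subset_of_nonneg (fun j hj => ?_) fun j hj _ => ?_
    · obtain ⟨hjA, hjR⟩ := Finset.mem_inter.1 hj
      exact Finset.mem_filter.2 ⟨hjR, (hA j hjA).2.2⟩
    · exact S.nonneg (S'.mem_available.1 (Finset.mem_filter.1 hj).1).1 t
  have hBh : B.card * h ≤ if ∃ k ∈ I.jobs, h ≤ I.p k then h else 0 := by
    rcases B.eq_empty_or_nonempty with rfl | ⟨k, hk⟩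
    · rw [Finset.card_empty, Nat.cast_zero, zero_mul]
      split_ifs <;> linarith
    · rw [if_pos ⟨k, hBI hk, by linarith [hB k hk, S.nonneg (hBI hk) s]⟩]
      have : (B.card : ℝ) ≤ 1 := by exact_mod_cast hBcard
      nlinarith
  linarith

/-- At every time, the hybrid rule has at most `4 / (1 - α)` times as many available jobs as any
other schedule. -/
theorem card_available_le (S S' : Schedule I) (h0 : 0 ≤ α) (hα : α < 1) (hf : Follows I α S.y t) :
    ((S.available t).card : ℝ) ≤ 4 / (1 - α) * (S'.available t).card := by
  classical
  set R := S'.available t with hR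
  set J := S.available t \ R with hJ
  have hβ : 0 < 1 - α := by linarith
  have hJI : ∀ j ∈ J, j ∈ I.jobs ∧ 0 < S.rem j t := fun j hj => by
    obtain ⟨h1, -, h3⟩ := S.mem_available.1 (Finset.mem_sdiff.1 hj).1
    exact ⟨h1, sub_pos.2 h3⟩
  have hRy : ∀ i ∈ R, 0 ≤ S.y i t := fun i hi => S.nonneg (S'.mem_available.1 hi).1 t
  have hcard : (S.available t).card ≤ J.card + R.card := by
    rw [hJ, ← Finset.card_union_of_disjoint Finset.sdiff_disjoint]
    exact Finset.card_le_card fun j hj => by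
      by_cases hjR : j ∈ R <;> simp [hj, hjR]
  rcases R.eq_empty_or_nonempty with hRe | hRne
  · have hP : 0 ≤ ∑ j ∈ I.jobs, I.p j := Finset.sum_nonneg fun j hj => (I.p_pos j hj).le
    have hple : ∀ j ∈ I.jobs, I.p j ≤ ∑ j ∈ I.jobs, I.p j := fun j hj =>
      Finset.single_le_sum (fun i hi => (I.p_pos i hi).le) hj
    have hsum := sum_rem_le S S' h0 hα hf (h := ∑ j ∈ I.jobs, I.p j + 1) (by linarith)
    rw [if_neg (by
      rintro ⟨k, hk, hle⟩
      linarith [hple k hk]), ← hR, hRe, Finset.filter_empty, Finset.sum_empty, add_zero] at hsum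
    have hJe : J = ∅ := by
      by_contra hne
      obtain ⟨j, hj⟩ := Finset.nonempty_iff_ne_empty.2 hne
      have hjI := hJI j hj
      have hle : S.rem j t ≤ ∑ j ∈ I.jobs, I.p j :=
        le_trans (by unfold Schedule.rem; linarith [S.nonneg hjI.1 t]) (hple j hjI.1)
      have hmem : j ∈ (S.available t \ ∅).filter
          fun j => S.rem j t < ∑ j ∈ I.jobs, I.p j + 1 := by
        refine Finset.mem_filter.2 ⟨by rwa [← hRe], by linarith⟩
      have := Finset.single_le_sum (f := fun j => S.rem j t) (fun i hi => (hJI i (by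
        rw [hJ, hRe]; exact (Finset.mem_filter.1 hi).1)).2.le) hmem
      linarith [hjI.2]
    rw [hJe, hRe] at hcard
    have : (S.available t).card = 0 := by simpa using hcard
    rw [this]
    simp [hRe]
  · set c := ⌈1 / (1 - α)⌉₊ with hc
    have hc1 : 1 ≤ c * (1 - α) := by
      have := Nat.le_ceil (1 / (1 - α))
      rwa [div_le_iff₀ hβ] at this
    have hJcard : J.card ≤ (R ×ˢ Finset.range c).card + 1 := by
      refine card_le_card_add_one (fun j => S.rem j t) (fun i : ℕ × ℕ => (1 - α) * S.y i.1 t) _ J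
        (fun j hj => (hJI j hj).2) fun j hj => ?_
      set u := S.rem j t with hu
      have hupos : 0 < u := (hJI j hj).2
      have hXY : ∑ i ∈ R with (1 - α) * S.y i t ≤ u, S.y i t ≤
          ∑ i ∈ R ×ˢ Finset.range c with (1 - α) * S.y i.1 t ≤ u, (1 - α) * S.y i.1 t := by
        have : (R ×ˢ Finset.range c).filter (fun i => (1 - α) * S.y i.1 t ≤ u) =
            (R.filter fun i => (1 - α) * S.y i t ≤ u) ×ˢ Finset.range c := by
          ext i
          simp only [Finset.mem_filter, Finset.mem_product]
          tauto
        rw [this, Finset.sum_product]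
        refine Finset.sum_le_sum fun i hi => ?_
        have := hRy i (Finset.mem_filter.1 hi).1
        simp only [Finset.sum_const, Finset.card_range, nsmul_eq_mul]
        nlinarith
      refine le_trans ?_ (add_le_add_left hXY u)
      have hev : ∀ᶠ h in 𝓝[>] u, ∀ i ∈ R, (1 - α) * S.y i t ≤ h → (1 - α) * S.y i t ≤ u := by
        rw [Filter.eventually_all_finset]
        intro i _
        by_cases hle : (1 - α) * S.y i t ≤ u
        · simp [hle]
        · filter_upwards [nhdsWithin_le_nhds (Iio_mem_nhds (not_le.1 hle))] with h hh hle'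
          exact absurd hle' (not_le.2 hh)
      have hlim : Tendsto (fun h => ∑ i ∈ R with (1 - α) * S.y i t ≤ u, S.y i t + h) (𝓝[>] u)
          (𝓝 (∑ i ∈ R with (1 - α) * S.y i t ≤ u, S.y i t + u)) :=
        ((continuous_const.add continuous_id).tendsto u).mono_left nhdsWithin_le_nhds
      refine ge_of_tendsto hlim ?_
      filter_upwards [hev, self_mem_nhdsWithin] with h hh hlt
      rw [mem_Ioi] at hlt
      have h1 := sum_rem_le S S' h0 hα hf (h := h) (hupos.trans hlt)
      have h2 : ∑ i ∈ J with S.rem i t ≤ u, S.rem i t ≤ ∑ i ∈ J with S.rem i t < h, S.rem i t :=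
        Finset.sum_le_sum_of_subset_of_nonneg
          (Finset.monotone_filter_right _ fun i _ hi => lt_of_le_of_lt hi hlt)
          fun i hi _ => (hJI i (Finset.mem_filter.1 hi).1).2.le
      have h3 : ∑ i ∈ R with (1 - α) * S.y i t ≤ h, S.y i t ≤
          ∑ i ∈ R with (1 - α) * S.y i t ≤ u, S.y i t :=
        Finset.sum_le_sum_of_subset_of_nonneg
          (fun i hi => by
            rw [Finset.mem_filter] at hi ⊢
            exact ⟨hi.1, hh i hi.1 hi.2⟩)
          fun i hi _ => hRy i (Finset.mem_filter.1 hi).1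
      have h4 : (if ∃ k ∈ I.jobs, h ≤ I.p k then h else 0) ≤ h := by
        split_ifs <;> linarith
      linarith
    rw [Finset.card_product, Finset.card_range] at hJcard
    have hRpos := hRne.card_pos
    have hnat : (S.available t).card ≤ (c + 2) * R.card := by nlinarith
    have hcle : (c : ℝ) + 2 ≤ 4 / (1 - α) := by
      have h1 : (c : ℝ) < 1 / (1 - α) + 1 := Nat.ceil_lt_add_one (by positivity)
      have h2 : 1 ≤ 1 / (1 - α) := by rw [le_div_iff₀ hβ]; linarith
      have h3 : 4 / (1 - α) = 4 * (1 / (1 - α)) := by ring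
      linarith
    calc ((S.available t).card : ℝ) ≤ ((c + 2) * R.card : ℕ) := by exact_mod_cast hnat
      _ = ((c : ℝ) + 2) * R.card := by push_cast; ring
      _ ≤ 4 / (1 - α) * R.card := by gcongr

end Local

/-! ### Total flow time -/

namespace Schedule

open MeasureTheory

variable {I : Instance} (S : Schedule I)

theorem card_available_eq_sum (t : ℝ) : ((S.available t).card : ℝ) =
    ∑ j ∈ I.jobs, (Ico (I.r j) (S.completion j)).indicator (fun _ => (1 : ℝ)) t := by
  classical
  rw [available, Finset.card_filter, Nat.cast_sum]
  refine Finset.sum_congr rfl fun j _ => ?_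
  simp [indicator_apply]

theorem integrable_indicator_Ico (j : ℕ) :
    Integrable ((Ico (I.r j) (S.completion j)).indicator (fun _ => (1 : ℝ))) := by
  rw [integrable_indicator_iff measurableSet_Ico]
  exact integrableOn_const (by simp)

theorem integrable_card_available : Integrable fun t => ((S.available t).card : ℝ) := by
  simp only [card_available_eq_sum]
  exact integrable_finsetSum _ fun j _ => S.integrable_indicator_Ico j

theorem flowTime_eq_integral : S.flowTime = ∫ t, ((S.available t).card : ℝ) := by
  simp only [card_available_eq_sum]
  rw [integral_finsetSum _ fun j _ => S.integrable_indicator_Ico j]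
  refine Finset.sum_congr rfl fun j hj => ?_
  rw [integral_indicator measurableSet_Ico]
  simp [(S.completion_mem hj).1]

end Schedule

theorem hybrid_isCompetitive {α : ℝ} (h0 : 0 ≤ α) (hα : α < 1) :
    (hybrid hα).IsCompetitive (4 / (1 - α)) := by
  intro I S
  rw [Schedule.flowTime_eq_integral, Schedule.flowTime_eq_integral,
    ← MeasureTheory.integral_const_mul]
  exact MeasureTheory.integral_mono (Schedule.integrable_card_available _)
    (S.integrable_card_available.const_mul _)
    fun t => card_available_le _ S h0 hα (hybrid_follows hα I t)

end FlowTime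

theorem theorem1 :
    ∃ K : ℝ, 0 < K ∧ ∀ α : ℝ, 0 ≤ α → α < 1 →
      ∃ A : FlowTime.Algorithm,
        A.IsClairvoyantOnline α ∧
        (∀ I : FlowTime.Instance, (A I).IsHybrid α) ∧
        A.IsCompetitive (K / (1 - α)) :=
  ⟨4, by norm_num, fun _ h0 hα => ⟨FlowTime.hybrid hα, FlowTime.hybrid_isClairvoyantOnline hα,
    fun I => (FlowTime.hybrid hα I).isHybrid_of_follows hα (FlowTime.hybrid_follows hα I),
    FlowTime.hybrid_isCompetitive h0 hα⟩⟩
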